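/- A \emph{signed graph} is a finite simple graph each of whose edges has a sign, $+1$ or $-1$; it is \emph{complete} if every two distinct vertices are joined by an edge. A \emph{valid drawing} of a signed graph in the Euclidean line is an injective map $D$ from its vertex set to $\mathbb{R}$ such that $|D(p)-D(q)|<|D(p)-D(r)|$ whenever $pq$ is a positive edge and $pr$ is a negative edge, i.e. every vertex is placed strictly closer to each of its positive neighbours than to each of its negative neighbours. \textbf{Theorem.} There is an algorithm which, given a complete signed graph $G$ on $n$ vertices, decides in time $O(n^2)$ whether $G$ has a valid drawing in the Euclidean line. Furthermore, there is an algorithm which, given a complete signed graph $G$ on $n$ vertices that has a valid drawing in the Euclidean line, computes such a drawing in time $O(n^2)$. Here an algorithm is a fixed word-RAM program; the graph is given by its signed adjacency matrix, the time is the number of elementary steps (constants, register and memory accesses, additions, truncated subtractions, multiplications, comparisons, assignments), all on words of $O(\log n)$ bits, and the drawing that is computed has natural-number coordinates, each of which fits in one word. -/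

import Mathlib

/-! ### Signed graphs and valid drawings -/

/-- A signed graph on the vertex set `V`: a graph together with a sign `1` or `-1`
for each of its edges. -/
structure SignedGraph (V : Type*) where
  graph : SimpleGraph V
  sign : graph.edgeSet → ℤˣ

namespace SignedGraph

variable {V : Type*}

/-- `u` and `v` are joined by a positive edge. -/
def PosAdj (G : SignedGraph V) (u v : V) : Prop :=
  ∃ h : s(u, v) ∈ G.graph.edgeSet, G.sign ⟨s(u, v), h⟩ = 1

/-- `u` and `v` are joined by a negative edge. -/
def NegAdj (G : SignedGraph V) (u v : V) : Prop :=
  ∃ h : s(u, v) ∈ G.graph.edgeSet, G.sign ⟨s(u, v), h⟩ = -1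

/-- Every pair of distinct vertices is joined by a (signed) edge. -/
def IsComplete (G : SignedGraph V) : Prop :=
  G.graph = ⊤

/-- An injective placement of the vertices in a metric space is a valid drawing if every vertex
is strictly closer to each of its positive neighbours than to each of its negative neighbours. -/
def IsValidDrawing (G : SignedGraph V) {X : Type*} [MetricSpace X] (D : V → X) : Prop :=
  Function.Injective D ∧
    ∀ p q r : V, G.PosAdj p q → G.NegAdj p r → dist (D p) (D q) < dist (D p) (D r)

/-- The signed graph has a valid drawing in the Euclidean line. -/
def HasLineDrawing (G : SignedGraph V) : Prop :=
  ∃ D : V → ℝ, G.IsValidDrawing D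

open Classical in
/-- Entry of the signed adjacency matrix that is given to an algorithm:
`1` for a positive edge, `2` for a negative edge, `0` if there is no edge. -/
noncomputable def entry (G : SignedGraph V) (u v : V) : ℕ :=
  if G.PosAdj u v then 1 else if G.NegAdj u v then 2 else 0

end SignedGraph

/-! ### A word RAM with a step count -/

namespace WordRAM

/-- The memory: registers `reg 0, reg 1, …` and arrays `mem 0, mem 1, …`, the cell `i` of the array
`a` being `mem a i`. A program names only finitely many registers and arrays; the cells of an array
are addressed indirectly, by computed values. -/
structure State where
  reg : ℕ → ℕ
  mem : ℕ → ℕ → ℕ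

/-- Arithmetic expressions; `read a e` is the cell of the array `a` at the address `e`. -/
inductive Expr where
  | const (c : ℕ)
  | var (x : ℕ)
  | read (a : ℕ) (e : Expr)
  | add (e₁ e₂ : Expr)
  | sub (e₁ e₂ : Expr)
  | mul (e₁ e₂ : Expr)

namespace Expr

/-- The value of an expression (`sub` is truncated at `0`). -/
def eval (s : State) : Expr → ℕ
  | const c => c
  | var x => s.reg x
  | read a e => s.mem a (e.eval s)
  | add e₁ e₂ => e₁.eval s + e₂.eval s
  | sub e₁ e₂ => e₁.eval s - e₂.eval s
  | mul e₁ e₂ => e₁.eval s * e₂.eval s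

/-- The number of steps needed to evaluate an expression: one for each constant, register access,
memory access and arithmetic operation. -/
def cost : Expr → ℕ
  | const _ => 1
  | var _ => 1
  | read _ e => e.cost + 1
  | add e₁ e₂ => e₁.cost + e₂.cost + 1
  | sub e₁ e₂ => e₁.cost + e₂.cost + 1
  | mul e₁ e₂ => e₁.cost + e₂.cost + 1

/-- No overflow: all values that occur while the expression is evaluated are words,
that is, are smaller than `W`. -/
def Fits (W : ℕ) (s : State) : Expr → Prop
  | const c => c < W
  | var x => s.reg x < W
  | read a e => e.Fits W s ∧ s.mem a (e.eval s) < W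
  | add e₁ e₂ => e₁.Fits W s ∧ e₂.Fits W s ∧ e₁.eval s + e₂.eval s < W
  | sub e₁ e₂ => e₁.Fits W s ∧ e₂.Fits W s
  | mul e₁ e₂ => e₁.Fits W s ∧ e₂.Fits W s ∧ e₁.eval s * e₂.eval s < W

end Expr

/-- Programs: assignment to a register, assignment `a[e₁] := e₂` to a cell of an array, sequential
composition, `if e₁ < e₂ then p else q`, and `while e₁ < e₂ do p`. -/
inductive Prog where
  | assign (x : ℕ) (e : Expr)
  | store (a : ℕ) (e₁ e₂ : Expr)
  | seq (p q : Prog)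
  | cond (e₁ e₂ : Expr) (p q : Prog)
  | loop (e₁ e₂ : Expr) (p : Prog)

/-- `Exec W p s t s'`: on a machine whose words are the numbers smaller than `W`, the program `p`,
started in the state `s`, halts without overflow after exactly `t` steps in the state `s'`. -/
inductive Exec (W : ℕ) : Prog → State → ℕ → State → Prop where
  | assign {x : ℕ} {e : Expr} {s : State} (h : e.Fits W s) :
      Exec W (.assign x e) s (e.cost + 1) ⟨Function.update s.reg x (e.eval s), s.mem⟩
  | store {a : ℕ} {e₁ e₂ : Expr} {s : State} (h₁ : e₁.Fits W s) (h₂ : e₂.Fits W s) :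
      Exec W (.store a e₁ e₂) s (e₁.cost + e₂.cost + 1)
        ⟨s.reg, Function.update s.mem a (Function.update (s.mem a) (e₁.eval s) (e₂.eval s))⟩
  | seq {p q : Prog} {s s' s'' : State} {t t' : ℕ} (hp : Exec W p s t s')
      (hq : Exec W q s' t' s'') : Exec W (.seq p q) s (t + t') s''
  | cond_true {e₁ e₂ : Expr} {p q : Prog} {s s' : State} {t : ℕ} (h₁ : e₁.Fits W s)
      (h₂ : e₂.Fits W s) (h : e₁.eval s < e₂.eval s) (hp : Exec W p s t s') :
      Exec W (.cond e₁ e₂ p q) s (e₁.cost + e₂.cost + 1 + t) s'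
  | cond_false {e₁ e₂ : Expr} {p q : Prog} {s s' : State} {t : ℕ} (h₁ : e₁.Fits W s)
      (h₂ : e₂.Fits W s) (h : ¬ e₁.eval s < e₂.eval s) (hq : Exec W q s t s') :
      Exec W (.cond e₁ e₂ p q) s (e₁.cost + e₂.cost + 1 + t) s'
  | loop_true {e₁ e₂ : Expr} {p : Prog} {s s' s'' : State} {t t' : ℕ} (h₁ : e₁.Fits W s)
      (h₂ : e₂.Fits W s) (h : e₁.eval s < e₂.eval s) (hp : Exec W p s t s')
      (hl : Exec W (.loop e₁ e₂ p) s' t' s'') :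
      Exec W (.loop e₁ e₂ p) s (e₁.cost + e₂.cost + 1 + t + t') s''
  | loop_false {e₁ e₂ : Expr} {p : Prog} {s : State} (h₁ : e₁.Fits W s)
      (h₂ : e₂.Fits W s) (h : ¬ e₁.eval s < e₂.eval s) :
      Exec W (.loop e₁ e₂ p) s (e₁.cost + e₂.cost + 1) s

/-- The machine is deterministic. -/
theorem Exec.deterministic {W : ℕ} {p : Prog} {s s₁ s₂ : State} {t₁ t₂ : ℕ}
    (h₁ : Exec W p s t₁ s₁) (h₂ : Exec W p s t₂ s₂) : t₁ = t₂ ∧ s₁ = s₂ := by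
  induction h₁ generalizing t₂ s₂ with
  | assign _ => cases h₂; exact ⟨rfl, rfl⟩
  | store _ _ => cases h₂; exact ⟨rfl, rfl⟩
  | seq _ _ ihp ihq =>
    cases h₂ with
    | seq hp hq =>
      obtain ⟨rfl, rfl⟩ := ihp hp
      obtain ⟨rfl, rfl⟩ := ihq hq
      exact ⟨rfl, rfl⟩
  | cond_true _ _ h _ ih =>
    cases h₂ with
    | cond_true _ _ _ hp => obtain ⟨rfl, rfl⟩ := ih hp; exact ⟨rfl, rfl⟩
    | cond_false _ _ h' _ => exact absurd h h'
  | cond_false _ _ h _ ih =>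
    cases h₂ with
    | cond_true _ _ h' _ => exact absurd h' h
    | cond_false _ _ _ hq => obtain ⟨rfl, rfl⟩ := ih hq; exact ⟨rfl, rfl⟩
  | loop_true _ _ h _ _ ihp ihl =>
    cases h₂ with
    | loop_true _ _ _ hp hl =>
      obtain ⟨rfl, rfl⟩ := ihp hp
      obtain ⟨rfl, rfl⟩ := ihl hl
      exact ⟨rfl, rfl⟩
    | loop_false _ _ h' => exact absurd h h'
  | loop_false _ _ h =>
    cases h₂ with
    | loop_true _ _ h' _ _ => exact absurd h' h
    | loop_false _ _ _ => exact ⟨rfl, rfl⟩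

/-- The initial state for a signed graph on `n` vertices: `n` is in register `0`, the signed
adjacency matrix is stored row by row in the first `n * n` cells of array `0` (the entry of the pair
`(i, j)` in cell `i * n + j`), and everything else is `0`. -/
noncomputable def input {n : ℕ} (G : SignedGraph (Fin n)) : State where
  reg x := if x = 0 then n else 0
  mem a k :=
    if h : a = 0 ∧ k < n * n then G.entry (Fin.divNat ⟨k, h.2⟩) (Fin.modNat ⟨k, h.2⟩) else 0

/-- A task on the signed graphs that satisfy `Inst`, with `Goal G s` saying that the final state `s`
is a correct answer for `G`, is solvable in time `O(f(n))`: a single program gives a correct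
answer for every such graph on `n` vertices, in at most `T n` steps, with `T = O(f)`, on a machine
whose words have `w n` bits, with `w = O(log n)`. -/
def SolvableInTime (f : ℕ → ℝ) (Inst : ∀ n : ℕ, SignedGraph (Fin n) → Prop)
    (Goal : ∀ n : ℕ, SignedGraph (Fin n) → State → Prop) : Prop :=
  ∃ (p : Prog) (T w : ℕ → ℕ),
    Asymptotics.IsBigO Filter.atTop (fun n => (T n : ℝ)) f ∧
    Asymptotics.IsBigO Filter.atTop (fun n => (w n : ℝ)) (fun n => Real.log (n : ℝ)) ∧
    ∀ (n : ℕ) (G : SignedGraph (Fin n)), Inst n G →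
      ∃ (t : ℕ) (s : State), Exec (2 ^ w n) p (input G) t s ∧ t ≤ T n ∧ Goal n G s

end WordRAM

/-! Let `r` be the relation "equal or joined by a positive edge". In a valid drawing, a vertex
between two related vertices is no farther from either of them than they are from each other, so it
is related to both: the drawing is an umbrella order of `r` (`isUmbrella_of_drawing`). Conversely,
every umbrella order yields coordinates for which two vertices are at distance at most `n` exactly
when they are related (`IsLayout.coord_le_iff`, `isValidDrawing_of_layout`). So drawability means
that `r` has an umbrella order, i.e. that the positive graph is a proper interval graph.

An umbrella order is found by two breadth-first sweeps. The first breaks ties in favour of large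
degree; the last vertex it visits in a component is, up to twins, an end of that component in any
umbrella order (`IsSweep.last_is_end`). The second starts each component at that vertex and breaks
ties in favour of small degree; it follows the umbrella order or its reverse up to exchanging twins
(`IsSweep.follows`), hence is an umbrella order itself (`IsSweep.isUmbrella`). Whether the outcome
is one can be tested locally (`isUmbrellaOn_iff`).

For the coordinates, the earlier non-neighbours of a vertex in an umbrella order form an initial
segment. Taking its last member (or a root `0`) as parent gives a forest with monotone parent
function. Node `j` with subtree size `z j` owns the interval `[E j, E j + z j)`, and the intervals
of its children fill this interval, without its first unit, shifted by `n`. Distances are thereby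
compared with `n` through the forest alone, and coordinates stay quadratic in `n`.

Programs are verified by weakest-precondition rules (`Runs`) and one rule for counting loops. A
sweep keeps an array of numeric priorities, with linear-time selection and update per visited
vertex. -/

/-! ### Umbrella orders -/

/-- `D` orders the vertices in such a way that everything between two related vertices is related
to both of them. -/
def IsUmbrella {V α : Type*} [LE α] (r : V → V → Prop) (D : V → α) : Prop :=
  ∀ u v w, D u ≤ D v → D v ≤ D w → r u w → r u v ∧ r v w

/-- `u` and `v` are related to the same vertices. -/
def Twin {V : Type*} (r : V → V → Prop) (u v : V) : Prop :=
  ∀ w, r u w ↔ r v w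

/-- The order `σ` is produced by a search that always proceeds with a vertex whose first visited
neighbour is as early as possible, ties being broken by `b`; vertices without a visited neighbour
come last, ties being broken by `a`. -/
structure IsSweep {V : Type*} (r : V → V → Prop) (σ a b : V → ℕ) : Prop where
  first : ∀ u v x, σ u < σ v → r x v → σ x < σ u → ∃ y, r y u ∧ σ y ≤ σ x
  tie : ∀ u v x, σ u < σ v → r x u → r x v → σ x < σ u →
    (∀ y, r y u → σ x ≤ σ y) → (∀ y, r y v → σ x ≤ σ y) → b u ≤ b v
  fresh : ∀ u v, σ u < σ v → (∀ y, r y u → σ u ≤ σ y) → a u ≤ a v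

section Sweep

variable {V : Type*} {r : V → V → Prop}

theorem IsUmbrella.neg {D : V → ℝ} (hsymm : ∀ u v, r u v → r v u) (h : IsUmbrella r D) :
    IsUmbrella r (fun v => -D v) := by
  intro u v w huv hvw huw
  have := h w v u (by linarith) (by linarith) (hsymm _ _ huw)
  exact ⟨hsymm _ _ this.2, hsymm _ _ this.1⟩

/-- An edge of the path jumping from before `x` to after `x` would, by `first`, give `x` a neighbour
visited before it, against `hx`. This is what makes components consecutive blocks of a sweep. -/
theorem IsSweep.reach_lt {σ a b : V → ℕ} (hσ : Function.Injective σ) (h : IsSweep r σ a b) {x : V}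
    (hx : ∀ y, r y x → σ x ≤ σ y) {u v : V} (huv : Relation.ReflTransGen r u v)
    (hu : σ u < σ x) : σ v < σ x := by
  induction huv with
  | refl => exact hu
  | @tail v w _ hvw ih =>
    by_contra hcon
    rcases (not_lt.1 hcon).lt_or_eq with hlt | heq
    · obtain ⟨y, hy, hyv⟩ := h.first x w v hlt hvw ih
      exact absurd (hx y hy) (by omega)
    · obtain rfl := hσ heq
      exact absurd (hx v hvw) (by omega)

theorem exists_first (σ : V → ℕ) (P : V → Prop) (hP : ∃ v, P v) :
    ∃ v, P v ∧ ∀ w, P w → σ v ≤ σ w := by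
  obtain ⟨v, hv, hmin⟩ := (measure σ).wf.has_min {v | P v} hP
  exact ⟨v, hv, fun w hw => not_lt.1 (hmin w hw)⟩

theorem Relation.ReflTransGen.symm_of (hsymm : ∀ u v, r u v → r v u) {u v : V}
    (h : Relation.ReflTransGen r u v) : Relation.ReflTransGen r v u :=
  haveI : Std.Symm r := ⟨hsymm⟩
  Relation.ReflTransGen.stdSymm.symm _ _ h

/-- Without an earlier neighbour, `v` would open a new block, and `reach_lt` would place everything
reachable from `s`, including `v` itself, before `v`. -/
theorem IsSweep.exists_parent {σ a b : V → ℕ} (hσ : Function.Injective σ) (h : IsSweep r σ a b)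
    {s v : V} (hs : ∀ w, Relation.ReflTransGen r s w → σ s ≤ σ w)
    (hv : Relation.ReflTransGen r s v) (hne : v ≠ s) :
    ∃ p, r p v ∧ σ p < σ v ∧ ∀ y, r y v → σ p ≤ σ y := by
  by_cases hst : ∃ y, r y v ∧ σ y < σ v
  · obtain ⟨y, hyv, hy⟩ := hst
    obtain ⟨p, hp, hmin⟩ := exists_first σ (fun y => r y v) ⟨y, hyv⟩
    exact ⟨p, hp, (hmin y hyv).trans_lt hy, hmin⟩
  · push Not at hst
    have hlt : σ s < σ v := lt_of_le_of_ne (hs v hv) fun e => hne (hσ e).symm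
    exact absurd (h.reach_lt hσ hst hv hlt) (lt_irrefl _)

theorem twin_of_le [Finite V] {d : V → ℕ} (hd : ∀ v, d v = {w | r v w}.ncard) {u v : V}
    (hle : d u ≤ d v) (hsub : ∀ w, r v w → r u w) : Twin r v u := by
  have : {w | r v w} = {w | r u w} :=
    Set.eq_of_subset_of_ncard_le hsub (by rw [← hd, ← hd]; exact hle) (Set.toFinite _)
  intro w
  exact Set.ext_iff.1 this w

/-- A vertex `v` left of `u` has the same first neighbour `p` as `u`, and `p` lies right of `u`.
Having won the tie, `v` has at least the degree of `u`; as its neighbours are all neighbours of `u`,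
the two are twins. -/
theorem IsSweep.last_is_left_end [Finite V] {d : V → ℕ} (hd : ∀ v, d v = {w | r v w}.ncard)
    {N : ℕ} (hdN : ∀ v, d v ≤ N) (hsymm : ∀ u v, r u v → r v u)
    {D : V → ℝ} (hDinj : Function.Injective D) (hD : IsUmbrella r D)
    {σ a : V → ℕ} (hσ : Function.Injective σ) (h : IsSweep r σ a (fun v => N - d v))
    {s u : V} (hs : ∀ w, Relation.ReflTransGen r s w → σ s ≤ σ w)
    (hu : ∀ w, Relation.ReflTransGen r s w → σ w ≤ σ u) (hsu : Relation.ReflTransGen r s u)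
    (hus : D u < D s) {v : V} (hv : Relation.ReflTransGen r s v) (hvu : D v < D u) :
    Twin r v u := by
  -- Follow parents from `x` back towards `s`, which lies right of `u`: the edge that jumps over `u`
  -- ends in a neighbour of `u`.
  have chain : ∀ k x, σ x = k → Relation.ReflTransGen r s x → D x < D u →
      ∃ y, r y u ∧ σ y < σ x := by
    intro k
    induction k using Nat.strong_induction_on with
    | _ k ih =>
      rintro x rfl hx hxu
      obtain ⟨y, hyx, hy, -⟩ := h.exists_parent hσ hs hx (by rintro rfl; linarith)
      have hry : Relation.ReflTransGen r s y := hx.tail (hsymm _ _ hyx)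
      have hyu : y ≠ u := by
        rintro rfl
        have := hu x hx
        omega
      rcases lt_or_gt_of_ne (fun e => hyu (hDinj e)) with hlt | hgt
      · obtain ⟨y', hy', hlt'⟩ := ih _ hy y rfl hry hlt
        exact ⟨y', hy', hlt'.trans hy⟩
      · exact ⟨y, hsymm _ _ (hD x u y hxu.le (le_of_lt hgt) (hsymm _ _ hyx)).2, hy⟩
  have key : ∀ v, Relation.ReflTransGen r s v → D v < D u → r v u ∧ d u ≤ d v := by
    intro v hv hvu
    obtain ⟨p, hpv, hp, hmin⟩ := h.exists_parent hσ hs hv (by rintro rfl; linarith)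
    have hrp : Relation.ReflTransGen r s p := hv.tail (hsymm _ _ hpv)
    have hlt : σ v < σ u := lt_of_le_of_ne (hu v hv) fun e => by
      rw [hσ e] at hvu
      exact lt_irrefl _ hvu
    have hminu : ∀ y, r y u → σ p ≤ σ y := by
      intro y hy
      by_contra! hcon
      obtain ⟨y', hy', hle⟩ := h.first v u y hlt hy (hcon.trans hp)
      have := hmin y' hy'
      omega
    have hpu : D u < D p := by
      by_contra! hcon
      rcases hcon.lt_or_eq with hc | hc
      · obtain ⟨y, hy, hyp⟩ := chain _ p rfl hrp hc
        have := hminu y hy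
        omega
      · rw [hDinj hc] at hp
        omega
    have h2 := hD v u p hvu.le hpu.le (hsymm _ _ hpv)
    have h3 := h.tie v u p hlt hpv (hsymm _ _ h2.2) hp hmin hminu
    have := hdN u
    have := hdN v
    exact ⟨h2.1, by omega⟩
  refine twin_of_le hd (key v hv hvu).2 fun w hw => ?_
  rcases lt_or_ge (D w) (D u) with hlt | hge
  · exact hsymm _ _ (key w (hv.tail hw) hlt).1
  · exact (hD v u w hvu.le hge hw).2

/-- All vertices of the component of `u` to the left of `u` (in the order `D`) are twins of `u`. -/
def IsLeftEnd (r : V → V → Prop) (D : V → ℝ) (u : V) : Prop :=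
  ∀ v, Relation.ReflTransGen r u v → D v < D u → Twin r v u

theorem IsSweep.last_is_end [Finite V] {d : V → ℕ} (hd : ∀ v, d v = {w | r v w}.ncard)
    {N : ℕ} (hdN : ∀ v, d v ≤ N) (hsymm : ∀ u v, r u v → r v u)
    {D : V → ℝ} (hDinj : Function.Injective D) (hD : IsUmbrella r D)
    {σ a : V → ℕ} (hσ : Function.Injective σ) (h : IsSweep r σ a (fun v => N - d v)) {u : V}
    (hu : ∀ w, Relation.ReflTransGen r u w → σ w ≤ σ u) :
    IsLeftEnd r D u ∨ IsLeftEnd r (fun v => -D v) u := by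
  obtain ⟨s, hus, hs⟩ := exists_first σ (Relation.ReflTransGen r u) ⟨u, .refl⟩
  have hsu := hus.symm_of hsymm
  have hs' : ∀ w, Relation.ReflTransGen r s w → σ s ≤ σ w := fun w hw => hs w (hus.trans hw)
  have hu' : ∀ w, Relation.ReflTransGen r s w → σ w ≤ σ u := fun w hw => hu w (hus.trans hw)
  rcases lt_trichotomy (D u) (D s) with hlt | heq | hgt
  · exact Or.inl fun v hv hvu =>
      h.last_is_left_end hd hdN hsymm hDinj hD hσ hs' hu' hsu hlt (hsu.trans hv) hvu
  · left
    intro v hv hvu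
    have h1 := hs v hv
    have h2 := hu v hv
    rw [← hDinj heq] at h1
    rw [hσ (le_antisymm h1 h2)] at hvu
    exact absurd hvu (lt_irrefl _)
  · exact Or.inr fun v hv hvu =>
      h.last_is_left_end hd hdN hsymm (neg_injective.comp hDinj) (hD.neg hsymm) hσ hs' hu' hsu
        (by simpa using hgt) (hsu.trans hv) hvu

/-- Induction on the visiting time of `u`. If `v` comes later but lies left of `u`, the parent `p`
of `u` is left of `v` or a twin of it, so `v` was tied with `u` at `p` and has at least the degree
of `u`. Its neighbours are neighbours of `u`, so the two are twins. -/
theorem IsSweep.follows [Finite V] {d : V → ℕ} (hd : ∀ v, d v = {w | r v w}.ncard)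
    (hrefl : ∀ v, r v v) (hsymm : ∀ u v, r u v → r v u)
    {D : V → ℝ} (hDinj : Function.Injective D) (hD : IsUmbrella r D)
    {σ a : V → ℕ} (hσ : Function.Injective σ) (h : IsSweep r σ a d) {z : V}
    (hz : ∀ w, Relation.ReflTransGen r z w → σ z ≤ σ w) (hend : IsLeftEnd r D z) :
    ∀ u v, Relation.ReflTransGen r z u → Relation.ReflTransGen r z v → σ u < σ v →
      D u < D v ∨ Twin r u v := by
  suffices H : ∀ k u, σ u = k → ∀ v, Relation.ReflTransGen r z u → Relation.ReflTransGen r z v →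
      σ u < σ v → D u < D v ∨ Twin r u v from fun u => H _ u rfl
  intro k
  induction k using Nat.strong_induction_on with
  | _ k ih =>
    rintro u rfl v hu hv huv
    rcases lt_trichotomy (D u) (D v) with hlt | heq | hgt
    · exact Or.inl hlt
    · rw [hDinj heq] at huv
      exact absurd huv (lt_irrefl _)
    right
    by_cases huz : u = z
    · subst huz
      exact fun w => (hend v hv hgt w).symm
    obtain ⟨p, hpu, hp, hmin⟩ := h.exists_parent hσ hz hu huz
    have hrp : Relation.ReflTransGen r z p := hu.tail (hsymm _ _ hpu)
    -- Stated for all later vertices left of `u`, because it is applied again to neighbours `w` of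
    -- `v`.
    have sub : ∀ v, Relation.ReflTransGen r z v → σ u < σ v → D v < D u →
        r u v ∧ r p v ∧ ∀ y, r y v → σ p ≤ σ y := by
      intro v hv huv hvu
      have h1 : r u v ∧ r p v := by
        rcases ih _ hp p rfl v hrp hv (hp.trans huv) with hlt | htw
        · have := hD p v u hlt.le hvu.le hpu
          exact ⟨hsymm _ _ this.2, this.1⟩
        · exact ⟨hsymm _ _ ((htw u).1 hpu), hsymm _ _ ((htw p).1 (hrefl p))⟩
      refine ⟨h1.1, h1.2, fun y hy => ?_⟩
      by_contra! hcon
      obtain ⟨y', hy', hle⟩ := h.first u v y huv hy (hcon.trans hp)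
      have := hmin y' hy'
      omega
    obtain ⟨-, hpv, hminv⟩ := sub v hv huv hgt
    have hdeg := h.tie u v p huv hpu hpv hp hmin hminv
    suffices Twin r v u from fun w => (this w).symm
    refine twin_of_le hd hdeg fun w hw => ?_
    rcases le_or_gt (D u) (D w) with hge | hlt
    · exact (hD v u w (le_of_lt hgt) hge hw).2
    have hrw : Relation.ReflTransGen r z w := hv.tail hw
    rcases lt_trichotomy (σ u) (σ w) with h1 | h1 | h1
    · exact (sub w hrw h1 hlt).1
    · rw [hσ h1]; exact hrefl w
    · rcases (hminv w (hsymm _ _ hw)).lt_or_eq with h2 | h2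
      · rcases ih _ hp p rfl w hrp hrw h2 with h3 | h3
        · exact hsymm _ _ (hD p w u h3.le hlt.le hpu).2
        · exact hsymm _ _ ((h3 u).1 hpu)
      · rw [← hσ h2]
        exact hsymm _ _ hpu

/-- Twins are interchangeable in `r`, and by reflexivity related to each other, so an order
departing from `D` only among twins keeps the umbrella property. -/
theorem isUmbrella_of_follows {D : V → ℝ} (hrefl : ∀ v, r v v) (hsymm : ∀ u v, r u v → r v u)
    (hD : IsUmbrella r D) {u v w : V} (huw : r u w)
    (huv : u = v ∨ D u < D v ∨ Twin r u v) (hvw : v = w ∨ D v < D w ∨ Twin r v w) :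
    r u v ∧ r v w := by
  rcases huv with rfl | huv | huv
  · exact ⟨hrefl _, huw⟩
  · rcases hvw with rfl | hvw | hvw
    · exact ⟨huw, hrefl _⟩
    · exact hD u v w huv.le hvw.le huw
    · have := hsymm _ _ ((hvw u).2 (hsymm _ _ huw))
      exact ⟨this, hsymm _ _ ((hvw v).1 (hrefl v))⟩
  · exact ⟨(huv v).2 (hrefl v), (huv w).1 huw⟩

/-- Two successive sweeps find an umbrella order whenever there is one. -/
theorem IsSweep.isUmbrella [Finite V] {d : V → ℕ} (hd : ∀ v, d v = {w | r v w}.ncard)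
    {N : ℕ} (hdN : ∀ v, d v ≤ N) (hrefl : ∀ v, r v v) (hsymm : ∀ u v, r u v → r v u)
    {D : V → ℝ} (hDinj : Function.Injective D) (hD : IsUmbrella r D)
    {σ τ a : V → ℕ} (hσ : Function.Injective σ) (hτ : Function.Injective τ)
    (hσN : ∀ v, σ v < N) (h₁ : IsSweep r σ a (fun v => N - d v))
    (h₂ : IsSweep r τ (fun v => N - σ v) d) : IsUmbrella r τ := by
  intro u v w huv hvw huw
  obtain ⟨z, hvz, hz⟩ := exists_first τ (Relation.ReflTransGen r v) ⟨v, .refl⟩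
  obtain ⟨y, huy, hy⟩ := exists_first τ (Relation.ReflTransGen r u) ⟨u, .refl⟩
  have hzv := hvz.symm_of hsymm
  have hyu := huy.symm_of hsymm
  have hzst : ∀ x, r x z → τ z ≤ τ x := fun x hx => hz x (hvz.tail (hsymm _ _ hx))
  have hyst : ∀ x, r x y → τ y ≤ τ x := fun x hx => hy x (huy.tail (hsymm _ _ hx))
  have hzmin : ∀ x, Relation.ReflTransGen r z x → τ z ≤ τ x := fun x hx => hz x (hvz.trans hx)
  -- Two different starts would be separate blocks, and the block of `v` would have to lie between
  -- the related vertices `u` and `w`.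
  have hzy : z = y := by
    have hzvle := hz v .refl
    have hyule := hy u .refl
    apply hτ
    by_contra hne
    rcases lt_or_ge (τ u) (τ z) with h | h
    · have := h₂.reach_lt hτ hzst (Relation.ReflTransGen.single huw) h
      omega
    · rcases lt_or_gt_of_ne hne with h' | h'
      · have := h₂.reach_lt hτ hyst hzv h'
        omega
      · have := h₂.reach_lt hτ hzst hyu h'
        omega
  subst hzy
  have hzw := hyu.tail huw
  -- The second sweep picks the largest `σ` among fresh vertices; `σ < N` keeps the truncated
  -- subtraction `N - σ` faithful.
  have hlast : ∀ x, Relation.ReflTransGen r z x → σ x ≤ σ z := by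
    intro x hx
    rcases (hzmin x hx).lt_or_eq with h | h
    · have h3 := h₂.fresh z x h hzst
      have := hσN x
      have := hσN z
      omega
    · rw [hτ h]
  obtain ⟨E, hE, hfol⟩ : ∃ E : V → ℝ, IsUmbrella r E ∧ ∀ u v, Relation.ReflTransGen r z u →
      Relation.ReflTransGen r z v → τ u < τ v → E u < E v ∨ Twin r u v := by
    rcases h₁.last_is_end hd hdN hsymm hDinj hD hσ hlast with h | h
    · exact ⟨D, hD, h₂.follows hd hrefl hsymm hDinj hD hτ hzmin h⟩
    · exact ⟨_, hD.neg hsymm,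
        h₂.follows hd hrefl hsymm (neg_injective.comp hDinj) (hD.neg hsymm) hτ hzmin h⟩
  refine isUmbrella_of_follows hrefl hsymm hE huw ?_ ?_
  · rcases huv.lt_or_eq with h | h
    · exact Or.inr (hfol u v hyu hzv h)
    · exact Or.inl (hτ h)
  · rcases hvw.lt_or_eq with h | h
    · exact Or.inr (hfol v w hzv hzw h)
    · exact Or.inl (hτ h)

end Sweep

/-! ### Coordinates -/

/-- `q` is a forest on `{1, …, n}` with root `0` and monotone parent function, `z` gives the sizes of
its subtrees, and `E` is the coordinate function obtained from them. -/
structure IsLayout (n : ℕ) (q z E : ℕ → ℕ) : Prop where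
  mono : ∀ i < n, q i ≤ q (i + 1)
  lt : ∀ i, 1 ≤ i → i ≤ n → q i < i
  size : ∀ j ≤ n, z j = 1 + ∑ i ∈ Finset.Icc 1 n with q i = j, z i
  root : z 0 = n + 1
  zero : E 0 = 0
  succ : ∀ i < n, E (i + 1) = if q i < q (i + 1) then E (q (i + 1)) + n + 1 else E i + z i

namespace IsLayout

variable {n : ℕ} {q z E : ℕ → ℕ}

theorem mono' (h : IsLayout n q z E) {i j : ℕ} (hij : i ≤ j) (hj : j ≤ n) : q i ≤ q j := by
  induction j, hij using Nat.le_induction with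
  | base => exact le_rfl
  | succ j hij ih => exact (ih (by omega)).trans (h.mono j hj)

/-- Along siblings the recurrence telescopes: a first child starts `n + 1` after its parent, and
each further sibling starts where the previous one ends. -/
theorem coord_add_size (h : IsLayout n q z E) (h0 : q 0 = 0) {i : ℕ} (hi : 1 ≤ i) (hin : i ≤ n) :
    E i + z i = E (q i) + n + 1 + ∑ x ∈ Finset.Icc 1 i with q x = q i, z x := by
  induction i, hi using Nat.le_induction with
  | base =>
    -- Node `1` falls under the sibling branch, since `q 0 = q 1 = 0`; `z 0 = n + 1` gives it the
    -- offset of a first child.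
    have := h.succ 0 (by omega)
    have h1 : q 1 = 0 := by have := h.lt 1 le_rfl hin; omega
    simp [h0, h1, h.zero, h.root] at this
    simp [h1, this, h.zero, Finset.filter_singleton]
  | succ i hi ih =>
    have hs := h.succ i hin
    have hins : Finset.Icc 1 (i + 1) = insert (i + 1) (Finset.Icc 1 i) := by
      ext x; simp; omega
    have hni : i + 1 ∉ (Finset.Icc 1 i).filter (fun x => q x = q (i + 1)) := by simp
    rw [hins, Finset.filter_insert, if_pos rfl, Finset.sum_insert hni]
    split_ifs at hs with hlt
    · have hem : (Finset.Icc 1 i).filter (fun x => q x = q (i + 1)) = ∅ := by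
        apply Finset.filter_eq_empty_iff.2
        intro x hx
        have := h.mono' (Finset.mem_Icc.1 hx).2 (by omega)
        omega
      rw [hem, hs]
      simp
    · have heq : q (i + 1) = q i := le_antisymm (not_lt.1 hlt) (h.mono i hin)
      have := ih (by omega)
      rw [heq]
      omega

theorem coord_add_size_le (h : IsLayout n q z E) (h0 : q 0 = 0) {i : ℕ} (hi : 1 ≤ i) (hin : i ≤ n) :
    E i + z i ≤ E (q i) + n + z (q i) := by
  rw [h.coord_add_size h0 hi hin, h.size (q i) ((h.lt i hi hin).le.trans hin)]
  have : ∑ x ∈ Finset.Icc 1 i with q x = q i, z x ≤ ∑ x ∈ Finset.Icc 1 n with q x = q i, z x := by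
    apply Finset.sum_le_sum_of_subset
    intro x
    simp only [Finset.mem_filter, Finset.mem_Icc]
    omega
  omega

/-- The intervals `[E i, E i + z i)` are disjoint and in order. When the parent changes, the
interval of `i` ends at most `n` after that of `q i`, which by induction ends before the next parent
starts. -/
theorem add_size_le_succ (h : IsLayout n q z E) (h0 : q 0 = 0) : ∀ i < n, E i + z i ≤ E (i + 1) := by
  intro i
  induction i using Nat.strong_induction_on with
  | _ i ih =>
    intro hi
    have hs := h.succ i hi
    split_ifs at hs with hlt
    · have hi1 : 1 ≤ i := by
        by_contra hcon
        have := h.lt 1 le_rfl (by omega)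
        obtain rfl : i = 0 := by omega
        simp only [zero_add] at hlt
        omega
      have h1 := h.coord_add_size_le h0 hi1 hi.le
      have h2 := ih (q i) (h.lt i hi1 hi.le) ((h.lt i hi1 hi.le).trans hi)
      have hq := h.lt (i + 1) (by omega) hi
      have h3 : ∀ j, q i + 1 ≤ j → j ≤ q (i + 1) → E (q i + 1) ≤ E j := by
        intro j hj
        induction j, hj using Nat.le_induction with
        | base => intro; exact le_rfl
        | succ j hj ihj =>
          intro hj'
          have := ih j (by omega) (by omega)
          have := ihj (by omega)
          omega
      have := h3 (q (i + 1)) hlt le_rfl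
      omega
    · omega

theorem coord_mono (h : IsLayout n q z E) (h0 : q 0 = 0) {i j : ℕ} (hij : i ≤ j) (hj : j ≤ n) :
    E i ≤ E j := by
  induction j, hij using Nat.le_induction with
  | base => exact le_rfl
  | succ j hij ih =>
    have := h.add_size_le_succ h0 j hj
    have := ih (by omega)
    omega

theorem coord_lt (h : IsLayout n q z E) (h0 : q 0 = 0) {i j : ℕ} (hij : i < j) (hj : j ≤ n) :
    E i < E j := by
  have h1 := h.add_size_le_succ h0 i (by omega)
  have h2 := h.coord_mono h0 hij hj
  have h3 := h.size i (by omega)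
  simp only [Nat.succ_eq_add_one] at h2
  omega

/-- The vertices `i < j` are at distance at most `n` if and only if `i` is to the right of `q j`. -/
theorem coord_le_iff (h : IsLayout n q z E) (h0 : q 0 = 0) {i j : ℕ} (hij : i < j)
    (hj : j ≤ n) : E j ≤ E i + n ↔ q j < i := by
  have hlt := h.lt j (by omega) hj
  have h1 := h.coord_add_size h0 (by omega : 1 ≤ j) hj
  have hmem : z j ≤ ∑ x ∈ Finset.Icc 1 j with q x = q j, z x :=
    Finset.single_le_sum (f := z) (fun _ _ => Nat.zero_le _) (by simp; omega)
  -- If `i ≤ q j`, then `j` starts more than `n` after `q j`. If `q j < i`, the interval of `j` ends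
  -- at most `n` after that of `q j`, which ends no later than `E i`.
  constructor
  · intro hle
    by_contra! hcon
    have := h.coord_mono h0 hcon (by omega)
    omega
  · intro hq
    have h2 := h.coord_add_size_le h0 (by omega : 1 ≤ j) hj
    have h3 := h.add_size_le_succ h0 (q j) (by omega)
    have h4 := h.coord_mono h0 hq (by omega)
    simp only [Nat.succ_eq_add_one] at h4
    omega

end IsLayout

namespace WordRAM

/-! ### Total correctness -/

/-- The program `p`, started in `s`, halts without overflow, and `Q` holds of the number of steps and
the final state. -/
def Runs (W : ℕ) (p : Prog) (s : State) (Q : ℕ → State → Prop) : Prop :=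
  ∃ t s', Exec W p s t s' ∧ Q t s'

namespace Runs

variable {W : ℕ} {s : State} {Q R : ℕ → State → Prop}

theorem mono {p : Prog} (h : Runs W p s Q) (hQR : ∀ t s', Q t s' → R t s') : Runs W p s R := by
  obtain ⟨t, s', he, hQ⟩ := h
  exact ⟨t, s', he, hQR t s' hQ⟩

theorem assign_iff {x : ℕ} {e : Expr} :
    Runs W (.assign x e) s Q ↔
      e.Fits W s ∧ Q (e.cost + 1) ⟨Function.update s.reg x (e.eval s), s.mem⟩ := by
  constructor
  · rintro ⟨t, s', he, hQ⟩
    cases he with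
    | assign h => exact ⟨h, hQ⟩
  · rintro ⟨h, hQ⟩
    exact ⟨_, _, .assign h, hQ⟩

theorem store_iff {a : ℕ} {e₁ e₂ : Expr} :
    Runs W (.store a e₁ e₂) s Q ↔ (e₁.Fits W s ∧ e₂.Fits W s) ∧ Q (e₁.cost + e₂.cost + 1)
      ⟨s.reg, Function.update s.mem a (Function.update (s.mem a) (e₁.eval s) (e₂.eval s))⟩ := by
  constructor
  · rintro ⟨t, s', he, hQ⟩
    cases he with
    | store h₁ h₂ => exact ⟨⟨h₁, h₂⟩, hQ⟩
  · rintro ⟨⟨h₁, h₂⟩, hQ⟩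
    exact ⟨_, _, .store h₁ h₂, hQ⟩

theorem seq_iff {p q : Prog} :
    Runs W (.seq p q) s Q ↔
      Runs W p s (fun t s' => Runs W q s' (fun t' s'' => Q (t + t') s'')) := by
  constructor
  · rintro ⟨t, s', he, hQ⟩
    cases he with
    | seq hp hq => exact ⟨_, _, hp, _, _, hq, hQ⟩
  · rintro ⟨t, s', hp, t', s'', hq, hQ⟩
    exact ⟨_, _, .seq hp hq, hQ⟩

theorem cond_iff {e₁ e₂ : Expr} {p q : Prog} :
    Runs W (.cond e₁ e₂ p q) s Q ↔ (e₁.Fits W s ∧ e₂.Fits W s) ∧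
      ((e₁.eval s < e₂.eval s → Runs W p s (fun t s' => Q (e₁.cost + e₂.cost + 1 + t) s')) ∧
      (¬ e₁.eval s < e₂.eval s → Runs W q s (fun t s' => Q (e₁.cost + e₂.cost + 1 + t) s'))) := by
  constructor
  · rintro ⟨t, s', he, hQ⟩
    cases he with
    | cond_true h₁ h₂ h hp => exact ⟨⟨h₁, h₂⟩, fun _ => ⟨_, _, hp, hQ⟩, fun h' => absurd h h'⟩
    | cond_false h₁ h₂ h hp => exact ⟨⟨h₁, h₂⟩, fun h' => absurd h' h, fun _ => ⟨_, _, hp, hQ⟩⟩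
  · rintro ⟨⟨h₁, h₂⟩, hp, hq⟩
    by_cases h : e₁.eval s < e₂.eval s
    · obtain ⟨t, s', he, hQ⟩ := hp h
      exact ⟨_, _, .cond_true h₁ h₂ h he, hQ⟩
    · obtain ⟨t, s', he, hQ⟩ := hq h
      exact ⟨_, _, .cond_false h₁ h₂ h he, hQ⟩

end Runs

/-- `for x = 0, …, n - 1 do p`, where `n` is the content of register `0`. -/
def forLoop (x : ℕ) (p : Prog) : Prog :=
  .seq (.assign x (.const 0))
    (.loop (.var x) (.var 0) (.seq p (.assign x (.add (.var x) (.const 1)))))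

/-- Induction on the number of remaining rounds. Besides the `c` steps of the body, a round costs 3
for the guard and 4 for the increment; the final 5 is the initial assignment and the failing guard.
-/
theorem Runs.forLoop {W x n c : ℕ} {p : Prog} {s : State} {Q : ℕ → State → Prop}
    (I : ℕ → State → Prop) (hx : x ≠ 0) (hW : n + 1 < W) (hn : s.reg 0 = n)
    (h0 : I 0 ⟨Function.update s.reg x 0, s.mem⟩)
    (hstep : ∀ k < n, ∀ s, s.reg x = k → s.reg 0 = n → I k s → Runs W p s (fun t s' =>
      t ≤ c ∧ s'.reg x = k ∧ s'.reg 0 = n ∧ I (k + 1) ⟨Function.update s'.reg x (k + 1), s'.mem⟩))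
    (hQ : ∀ t s', t ≤ n * (c + 7) + 5 → s'.reg x = n → s'.reg 0 = n → I n s' → Q t s') :
    Runs W (forLoop x p) s Q := by
  have loop : ∀ m ≤ n, ∀ s, s.reg x = n - m → s.reg 0 = n → I (n - m) s →
      ∃ t s', Exec W (.loop (.var x) (.var 0) (.seq p (.assign x (.add (.var x) (.const 1)))))
        s t s' ∧ t ≤ m * (c + 7) + 3 ∧ s'.reg x = n ∧ s'.reg 0 = n ∧ I n s' := by
    intro m
    induction m with
    | zero =>
      intro _ s h1 h2 h3
      refine ⟨_, s, .loop_false ?_ ?_ ?_, ?_, h1, h2, h3⟩ <;> simp [Expr.Fits, Expr.eval, Expr.cost] <;> omega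
    | succ m ih =>
      intro hm s h1 h2 h3
      obtain ⟨t, s', he, ht, hx', h0', hI⟩ := hstep (n - (m + 1)) (by omega) s h1 h2 h3
      have hsub : n - (m + 1) + 1 = n - m := by omega
      rw [hsub] at hI
      obtain ⟨t', s'', he', ht', hfin⟩ := ih (by omega)
        ⟨Function.update s'.reg x (n - m), s'.mem⟩ (by simp)
        (by simp [Function.update_of_ne hx.symm, h0']) hI
      refine ⟨_, s'', .loop_true ?_ ?_ ?_ (.seq he (.assign (x := x) ?_)) (t' := t') ?_, ?_, hfin⟩
      · simp [Expr.Fits]; omega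
      · simp [Expr.Fits]; omega
      · simp [Expr.eval]; omega
      · simp [Expr.Fits, Expr.eval]; omega
      · convert he' using 3
        simp [Expr.eval, hx', hsub]
      · simp only [Expr.cost]
        have : (m + 1) * (c + 7) = m * (c + 7) + (c + 7) := by ring
        omega
  obtain ⟨t, s', he, ht, h1, h2, h3⟩ := loop n le_rfl ⟨Function.update s.reg x 0, s.mem⟩ (by simp)
    (by simp [Function.update_of_ne hx.symm, hn]) (by simpa using h0)
  refine ⟨_, s', .seq (.assign (x := x) ?_) he, hQ _ _ ?_ h1 h2 h3⟩
  · simp [Expr.Fits]; omega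
  · simp only [Expr.cost]; omega

/-! ### The search order -/

/-- `κ` is the priority of the vertex `v` when `ord 0, …, ord (k - 1)` have been visited. -/
def IsKey (n : ℕ) (r : ℕ → ℕ → Prop) (a b ord : ℕ → ℕ) (k v κ : ℕ) : Prop :=
  ((∀ j < k, ¬ r (ord j) v) ∧ κ = n * (n + 1) + a v) ∨
    ∃ j < k, r (ord j) v ∧ (∀ i < j, ¬ r (ord i) v) ∧ κ = j * (n + 1) + b v

/-- With `ord 0, …, ord (j - 1)` already visited, `u` may be visited before `v`. -/
structure Precedes (r : ℕ → ℕ → Prop) (a b ord : ℕ → ℕ) (j u v : ℕ) : Prop where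
  first : ∀ i < j, r (ord i) v → ∃ i' ≤ i, r (ord i') u
  tie : ∀ i < j, r (ord i) u → r (ord i) v →
    (∀ i' < i, ¬ r (ord i') u ∧ ¬ r (ord i') v) → b u ≤ b v
  fresh : (∀ i < j, ¬ r (ord i) u) → a u ≤ a v

/-- The vertices `ord 0, …, ord (k - 1)` are the result of the first `k` steps of a search. -/
structure IsSearch (n : ℕ) (r : ℕ → ℕ → Prop) (a b ord : ℕ → ℕ) (k : ℕ) : Prop where
  lt : ∀ j < k, ord j < n
  inj : ∀ i < k, ∀ j < k, ord i = ord j → i = j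
  precedes : ∀ j < k, ∀ v < n, (∀ i ≤ j, ord i ≠ v) → Precedes r a b ord j (ord j) v

section

variable {n k : ℕ} {r : ℕ → ℕ → Prop} {a b ord ord' : ℕ → ℕ}

/-- The bound is the value that marks visited vertices, so unvisited vertices always win the
selection. -/
theorem IsKey.lt {v κ : ℕ} (h : IsKey n r a b ord k v κ) (hk : k ≤ n) (ha : a v ≤ n) (hb : b v ≤ n) :
    κ < n * (n + 1) + (n + 1) := by
  rcases h with ⟨-, rfl⟩ | ⟨j, hj, -, -, rfl⟩
  · omega
  · have : (j + 1) * (n + 1) ≤ n * (n + 1) := Nat.mul_le_mul_right _ (by omega)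
    nlinarith

/-- Tie-breakers are at most `n`, so keys compare lexicographically: by the position of the first
visited neighbour, then by the tie-breaker. -/
theorem IsKey.precedes {u v κ κ' : ℕ} (hu : IsKey n r a b ord k u κ) (hv : IsKey n r a b ord k v κ')
    (hle : κ ≤ κ') (hk : k ≤ n) (hbv : b v ≤ n) : Precedes r a b ord k u v := by
  have aux : ∀ j < k, j * (n + 1) + (n + 1) ≤ n * (n + 1) := fun j hj => by
    have : (j + 1) * (n + 1) ≤ n * (n + 1) := Nat.mul_le_mul_right _ (by omega)
    linarith
  rcases hu with ⟨hu, rfl⟩ | ⟨j, hj, hju, hu, rfl⟩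
  · rcases hv with ⟨hv, rfl⟩ | ⟨j', hj', hj'v, hv, rfl⟩
    · exact ⟨fun i hi h => absurd h (hv i hi), fun i hi h => absurd h (hu i hi), fun _ => by omega⟩
    · have := aux j' hj'
      omega
  · have hjj : ∀ j' < k, j * (n + 1) + b u ≤ j' * (n + 1) + b v → j ≤ j' := fun j' _ h => by
      by_contra! hcon
      have : (j' + 1) * (n + 1) ≤ j * (n + 1) := Nat.mul_le_mul_right _ hcon
      linarith
    rcases hv with ⟨hv, rfl⟩ | ⟨j', hj', hj'v, hv, rfl⟩
    · exact ⟨fun i hi h => absurd h (hv i hi), fun i hi _ h => absurd h (hv i hi),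
        fun h => absurd hju (h j hj)⟩
    · have hle' := hjj j' hj' hle
      refine ⟨fun i hi h => ⟨j, ?_, hju⟩, fun i hi h1 h2 h3 => ?_, fun h => absurd hju (h j hj)⟩
      · exact hle'.trans (not_lt.1 fun h' => hv i h' h)
      · have e1 : i = j := by
          rcases lt_trichotomy i j with h | h | h
          · exact absurd h1 (hu i h)
          · exact h
          · exact absurd hju (h3 j h).1
        have e2 : i = j' := by
          rcases lt_trichotomy i j' with h | h | h
          · exact absurd h2 (hv i h)
          · exact h
          · exact absurd hj'v (h3 j' h).2
        subst e1 e2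
        omega

theorem IsKey.congr {v κ : ℕ} (h : IsKey n r a b ord k v κ) (ho : ∀ j < k, ord' j = ord j) :
    IsKey n r a b ord' k v κ := by
  rcases h with ⟨h, rfl⟩ | ⟨j, hj, hjv, h, rfl⟩
  · exact Or.inl ⟨fun j hj => by rw [ho j hj]; exact h j hj, rfl⟩
  · exact Or.inr ⟨j, hj, by rwa [ho j hj], fun i hi => by rw [ho i (hi.trans hj)]; exact h i hi, rfl⟩

theorem Precedes.congr {j u v : ℕ} (h : Precedes r a b ord j u v) (ho : ∀ i < j, ord' i = ord i) :
    Precedes r a b ord' j u v := by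
  refine ⟨fun i hi hr => ?_, fun i hi h1 h2 h3 => ?_, fun hr => ?_⟩
  · rw [ho i hi] at hr
    obtain ⟨i', hi', hr'⟩ := h.first i hi hr
    exact ⟨i', hi', by rwa [ho i' (by omega)]⟩
  · rw [ho i hi] at h1 h2
    exact h.tie i hi h1 h2 fun i' hi' => by rw [← ho i' (by omega)]; exact h3 i' hi'
  · exact h.fresh fun i hi => by rw [← ho i hi]; exact hr i hi

theorem IsSearch.extend (h : IsSearch n r a b ord k) {u : ℕ} (hun : u < n) (hu : ∀ j < k, ord j ≠ u)
    (hmin : ∀ v < n, (∀ j < k, ord j ≠ v) → v ≠ u → Precedes r a b ord k u v) :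
    IsSearch n r a b (Function.update ord k u) (k + 1) := by
  have ho : ∀ j < k, Function.update ord k u j = ord j := fun j hj =>
    Function.update_of_ne (by omega) _ _
  have hk : Function.update ord k u k = u := Function.update_self ..
  constructor
  · intro j hj
    rcases Nat.lt_succ_iff_lt_or_eq.1 hj with hj | rfl
    · rw [ho j hj]; exact h.lt j hj
    · rwa [hk]
  · intro i hi j hj
    rcases Nat.lt_succ_iff_lt_or_eq.1 hi with hi | rfl <;>
    rcases Nat.lt_succ_iff_lt_or_eq.1 hj with hj | rfl
    · rw [ho i hi, ho j hj]; exact h.inj i hi j hj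
    · rw [ho i hi, hk]; exact fun e => absurd e (hu i hi)
    · rw [ho j hj, hk]; exact fun e => absurd e.symm (hu j hj)
    · exact fun _ => rfl
  · intro j hj v hv hne
    rcases Nat.lt_succ_iff_lt_or_eq.1 hj with hj | rfl
    · rw [ho j hj]
      refine (h.precedes j hj v hv fun i hi => ?_).congr fun i hi => ho i (hi.trans hj)
      rw [← ho i (by omega)]
      exact hne i hi
    · rw [hk]
      refine (hmin v hv (fun i hi => ?_) ?_).congr ho
      · rw [← ho i hi]; exact hne i hi.le
      · have := hne j le_rfl
        rw [hk] at this
        exact this.symm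

theorem exists_unvisited (ord : ℕ → ℕ) (hk : k < n) :
    ∃ v < n, ∀ j < k, ord j ≠ v := by
  by_contra! hcon
  have hsub : Finset.range n ⊆ (Finset.range k).image ord := fun v hv => by
    obtain ⟨j, hj, e⟩ := hcon v (Finset.mem_range.1 hv)
    exact Finset.mem_image.2 ⟨j, Finset.mem_range.2 hj, e⟩
  have := (Finset.card_le_card hsub).trans Finset.card_image_le
  simp at this
  omega

/-- A complete search as an order on `Fin n`. -/
theorem IsSearch.exists_sweep (h : IsSearch n r a b ord n) :
    ∃ σ : Fin n ≃ Fin n, (∀ i : Fin n, (σ.symm i : ℕ) = ord i) ∧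
      IsSweep (fun u v : Fin n => r u v) (fun v => (σ v : ℕ)) (fun v => a v) (fun v => b v) := by
  let f : Fin n → Fin n := fun i => ⟨ord i, h.lt i i.2⟩
  have hf : Function.Injective f := fun i j e =>
    Fin.ext (h.inj i i.2 j j.2 (congrArg Fin.val e))
  let e : Fin n ≃ Fin n := Equiv.ofBijective f (Finite.injective_iff_bijective.1 hf)
  have he : ∀ v : Fin n, ord (e.symm v) = v := fun v => by
    have := congrArg Fin.val (e.apply_symm_apply v)
    exact this
  have hp : ∀ u v : Fin n, (e.symm u : ℕ) < e.symm v → Precedes r a b ord (e.symm u) u v := by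
    intro u v huv
    have := h.precedes (e.symm u) (e.symm u).2 v v.2 fun i hi heq => by
      rw [← he v] at heq
      have := h.inj i (by omega) _ (e.symm v).2 heq
      omega
    rwa [he u] at this
  refine ⟨e.symm, fun i => rfl, ⟨?_, ?_, ?_⟩⟩
  · intro u v x huv hxv hxu
    obtain ⟨i, hi, hr⟩ := (hp u v huv).first (e.symm x) hxu (by rwa [he])
    have hin : i < n := by omega
    exact ⟨e ⟨i, hin⟩, hr, by simpa using hi⟩
  · intro u v x huv hxu hxv hx hu hv
    refine (hp u v huv).tie (e.symm x) hx (by rwa [he]) (by rwa [he]) fun i hi => ?_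
    have hin : i < n := by omega
    constructor <;> intro hr
    · have := hu (e ⟨i, hin⟩) hr
      simp at this; omega
    · have := hv (e ⟨i, hin⟩) hr
      simp at this; omega
  · intro u v huv hu
    refine (hp u v huv).fresh fun i hi hr => ?_
    have hin : i < n := by omega
    have := hu (e ⟨i, hin⟩) hr
    simp at this; omega

end

/-! ### Programs: sweeps -/

theorem cell_lt {n i j : ℕ} (hi : i < n) (hj : j < n) : i * n + j < n * n := by
  have : (i + 1) * n ≤ n * n := Nat.mul_le_mul_right _ hi
  linarith

/-- The program that does nothing (it uses register `9` as scratch space). -/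
def skip : Prog := .assign 9 (.const 0)

/-- The entry of the matrix in array `0`. -/
def entryE (e₁ e₂ : Expr) : Expr := .read 0 (.add (.mul e₁ (.var 0)) e₂)

/-- Initialize the priorities (array `5`) from the numbers in array `4`. -/
def initKeys : Prog :=
  forLoop 2 (.store 5 (.var 2) (.add (.var 5) (.read 4 (.var 2))))

/-- Put into register `4` a vertex with smallest priority. -/
def selectMin : Prog :=
  .seq (.assign 3 (.var 6)) <| .seq (.assign 4 (.const 0)) <|
    forLoop 2 (.cond (.read 5 (.var 2)) (.var 3)
      (.seq (.assign 3 (.read 5 (.var 2))) (.assign 4 (.var 2))) skip)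

/-- Update the priorities after the visit of the vertex in register `4`. -/
def updateKeys (b : ℕ) : Prog :=
  forLoop 2 (.cond (.read 5 (.var 2)) (.var 6)
    (.cond (.var 5) (.add (.read 5 (.var 2)) (.const 1))
      (.cond (entryE (.var 4) (.var 2)) (.const 2)
        (.store 5 (.var 2) (.add (.mul (.var 1) (.add (.var 0) (.const 1))) (.read b (.var 2))))
        skip) skip) skip)

/-- Store in array `6` the order of a search with tie-breaking numbers in the arrays `4` and `b`. -/
def sweep (b : ℕ) : Prog :=
  .seq (.assign 5 (.mul (.var 0) (.add (.var 0) (.const 1)))) <|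
  .seq (.assign 6 (.add (.var 5) (.add (.var 0) (.const 1)))) <|
  .seq initKeys <|
  forLoop 1 <|
    .seq selectMin <|
    .seq (.store 6 (.var 1) (.var 4)) <|
    .seq (.store 5 (.var 4) (.var 6)) <|
    updateKeys b

section

variable {W n : ℕ} {s : State}

attribute [local simp] Runs.assign_iff Runs.store_iff Runs.seq_iff Runs.cond_iff Expr.Fits
  Expr.eval Expr.cost entryE skip Function.update_apply

theorem runs_initKeys {κ : ℕ} (hκ : κ + n < W) (hW : n + 1 < W) (hn : s.reg 0 = n)
    (h5 : s.reg 5 = κ) (ha : ∀ v < n, s.mem 4 v ≤ n) :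
    Runs W initKeys s (fun t s' => t ≤ n * 20 + 20 ∧ s'.reg 0 = n ∧ s'.reg 5 = κ ∧
      s'.reg 6 = s.reg 6 ∧ (∀ a, a ≠ 5 → s'.mem a = s.mem a) ∧
      ∀ v < n, s'.mem 5 v = κ + s.mem 4 v) := by
  refine Runs.forLoop (n := n) (c := 13) (fun k s' => s'.reg 5 = κ ∧ s'.reg 6 = s.reg 6 ∧
    (∀ a, a ≠ 5 → s'.mem a = s.mem a) ∧ ∀ v < k, s'.mem 5 v = κ + s.mem 4 v)
    (by decide) hW hn ?_ ?_ ?_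
  · simp [h5]
  · rintro k hk s₁ h2 h0 ⟨h5, h6, hm, hK⟩
    have := ha k hk
    have hm4 := hm 4 (by decide)
    simp [h0, h2, h5, h6, hm4]
    refine ⟨by omega, fun a ha => by simp [ha, hm a ha], fun v hv => ?_⟩
    split_ifs with h
    · rw [h]
    · exact hK v (by omega)
  · rintro t s' ht h2 h0 ⟨h5, h6, hm, hK⟩
    exact ⟨by omega, h0, h5, h6, hm, hK⟩

/-- The running minimum starts at the marker `β`; the candidate in register `4` becomes meaningful
once the minimum drops below `β`, which `hex` guarantees. -/
theorem runs_selectMin {β : ℕ} (hβ : β < W) (hW : n + 1 < W) (hn : s.reg 0 = n)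
    (h6 : s.reg 6 = β) (hK : ∀ v < n, s.mem 5 v ≤ β) (hex : ∃ v < n, s.mem 5 v < β) :
    Runs W selectMin s (fun t s' => t ≤ n * 20 + 20 ∧ s'.reg 0 = n ∧ s'.reg 1 = s.reg 1 ∧
      s'.reg 5 = s.reg 5 ∧ s'.reg 6 = s.reg 6 ∧ s'.mem = s.mem ∧ s'.reg 4 < n ∧
      s.mem 5 (s'.reg 4) < β ∧ ∀ v < n, s.mem 5 (s'.reg 4) ≤ s.mem 5 v) := by
  simp only [selectMin, Runs.seq_iff, Runs.assign_iff]
  refine ⟨by simp [h6, hβ], by simp; omega, ?_⟩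
  refine Runs.forLoop (n := n) (c := 12) (fun k s' => s'.reg 1 = s.reg 1 ∧
    s'.reg 5 = s.reg 5 ∧ s'.reg 6 = s.reg 6 ∧ s'.mem = s.mem ∧ s'.reg 3 ≤ β ∧
    (∀ v < k, s'.reg 3 ≤ s.mem 5 v) ∧
    (s'.reg 3 < β → s'.reg 4 < k ∧ s'.reg 3 = s.mem 5 (s'.reg 4)))
    (by decide) hW (by simpa using hn) ?_ ?_ ?_
  · simp [h6]
  · rintro k hk s₁ h2 h0 ⟨h1, h5, h6, hm, h3, hmin, h4⟩
    have := hK k hk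
    simp [h0, h2, h1, h5, h6, hm]
    refine ⟨by omega, ?_, ?_⟩
    · intro hlt
      refine ⟨by omega, by omega, this, fun v hv => ?_⟩
      rcases hv.lt_or_eq with hv | rfl
      · exact hlt.le.trans (hmin v hv)
      · exact le_rfl
    · intro hle
      refine ⟨by omega, h3, fun v hv => ?_, fun h => ⟨?_, (h4 h).2⟩⟩
      · rcases hv.lt_or_eq with hv | rfl
        · exact hmin v hv
        · exact hle
      · have := (h4 h).1
        omega
  · rintro t s' ht h2 h0 ⟨h1, h5, h6, hm, h3, hmin, h4⟩
    obtain ⟨v, hv, hvβ⟩ := hex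
    have hlt := (hmin v hv).trans_lt hvβ
    obtain ⟨h4, he⟩ := h4 hlt
    exact ⟨by simp; omega, h0, h1, h5, h6, hm, h4, he ▸ hlt, fun v hv => he ▸ hmin v hv⟩

/-- The priorities after the visit of `u` as the vertex with the number `k`. -/
def newKey (n : ℕ) (m b K : ℕ → ℕ) (k u v : ℕ) : ℕ :=
  if K v < n * (n + 1) + (n + 1) ∧ n * (n + 1) ≤ K v ∧ m (u * n + v) < 2 then
    k * (n + 1) + b v else K v

theorem runs_updateKeys {b k u : ℕ} (hb : b ≠ 5) (hW : 8 * (n + 2) ^ 2 ≤ W) (hn : s.reg 0 = n)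
    (h1 : s.reg 1 = k) (hk : k < n) (h4 : s.reg 4 = u) (hu : u < n) (h5 : s.reg 5 = n * (n + 1))
    (h6 : s.reg 6 = n * (n + 1) + (n + 1)) (hm : ∀ c, s.mem 0 c ≤ 2) (hB : ∀ v < n, s.mem b v ≤ n)
    (hK : ∀ v < n, s.mem 5 v ≤ n * (n + 1) + (n + 1)) :
    Runs W (updateKeys b) s (fun t s' => t ≤ n * 50 + 50 ∧ s'.reg 0 = n ∧ s'.reg 1 = k ∧
      s'.reg 5 = s.reg 5 ∧ s'.reg 6 = s.reg 6 ∧ (∀ a, a ≠ 5 → s'.mem a = s.mem a) ∧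
      ∀ v < n, s'.mem 5 v = newKey n (s.mem 0) (s.mem b) (s.mem 5) k u v) := by
  have hW' : 8 * (n * n) + 32 * n + 32 ≤ W := by nlinarith
  have hnn : n * (n + 1) = n * n + n := by ring
  have hkn : k * (n + 1) + (n + 1) ≤ n * n + n := by
    rw [← hnn]; nlinarith
  refine Runs.forLoop (n := n) (c := 40) (fun l s' => s'.reg 1 = k ∧ s'.reg 4 = u ∧
    s'.reg 5 = s.reg 5 ∧ s'.reg 6 = s.reg 6 ∧ (∀ a, a ≠ 5 → s'.mem a = s.mem a) ∧
      (∀ v, l ≤ v → s'.mem 5 v = s.mem 5 v) ∧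
      ∀ v < l, s'.mem 5 v = newKey n (s.mem 0) (s.mem b) (s.mem 5) k u v)
    (by decide) (by omega) hn ?_ ?_ ?_
  · simp [h1, h4]
  · rintro l hl s₁ e2 e0 ⟨e1, e4, e5, e6, em, eK, eK'⟩
    have em0 := em 0 (by decide)
    have emb := em b hb
    have hKl := hK l hl
    have hBl := hB l hl
    have hcell := cell_lt hu hl
    have hun : u * n ≤ n * n := Nat.mul_le_mul_right _ hu.le
    have hml := hm (u * n + l)
    have eKl := eK l le_rfl
    have keep : newKey n (s.mem 0) (s.mem b) (s.mem 5) k u l = s.mem 5 l →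
        ∀ v ≤ l, s₁.mem 5 v = newKey n (s.mem 0) (s.mem b) (s.mem 5) k u v := fun h v hv => by
      rcases hv.lt_or_eq with hv | rfl
      · exact eK' v hv
      · rw [h, eKl]
    have after : ∀ v, l < v → s₁.mem 5 v = s.mem 5 v := fun v hv => eK v hv.le
    simp [e0, e1, e2, e4, e5, e6, em0, emb, h5, h6, eKl]
    refine ⟨by omega, fun c1 => ⟨by omega, fun c2 => ⟨by omega, fun c3 => ⟨by omega, ?_, ?_, ?_⟩,
      fun c3 => ⟨by omega, em, after, keep ?_⟩⟩, fun c2 => ⟨by omega, em, after, keep ?_⟩⟩,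
      fun c1 => ⟨by omega, em, after, keep ?_⟩⟩
    · intro a ha
      rw [if_neg ha, em a ha]
    · intro v hv
      rw [if_neg (by omega), after v hv]
    · intro v hv
      rcases hv.lt_or_eq with hv | rfl
      · rw [if_neg (by omega), eK' v hv]
      · rw [if_pos rfl, newKey, if_pos ⟨c1, c2, by omega⟩]
    all_goals
      rw [newKey, if_neg]
      omega
  · rintro t s' ht h2 h0 ⟨h1, h4, h5, h6, hm, -, hK⟩
    exact ⟨by omega, h0, h1, h5, h6, hm, hK⟩

/-- The priorities `K` after the first `k` steps of a search. -/
structure IsKeys (n : ℕ) (r : ℕ → ℕ → Prop) (a b ord K : ℕ → ℕ) (k : ℕ) : Prop where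
  visited : ∀ j < k, K (ord j) = n * (n + 1) + (n + 1)
  unvisited : ∀ v < n, (∀ j < k, ord j ≠ v) → IsKey n r a b ord k v (K v)

variable {a b ord K K' m : ℕ → ℕ} {k u : ℕ} {r : ℕ → ℕ → Prop}

theorem IsKeys.le (h : IsKeys n r a b ord K k) (hk : k ≤ n) (ha : ∀ v < n, a v ≤ n)
    (hb : ∀ v < n, b v ≤ n) {v : ℕ} (hv : v < n) : K v ≤ n * (n + 1) + (n + 1) := by
  by_cases hvis : ∃ j < k, ord j = v
  · obtain ⟨j, hj, rfl⟩ := hvis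
    exact (h.visited j hj).le
  · push Not at hvis
    exact ((h.unvisited v hv hvis).lt hk (ha v hv) (hb v hv)).le

/-- The chosen vertex gets the marker before the update, so the update touches only unvisited
vertices; among these, only those whose first visited neighbour is `u` change their key. -/
theorem IsKeys.step (hr : ∀ i j, r i j ↔ m (i * n + j) < 2)
    (hs : IsSearch n r a b ord k) (h : IsKeys n r a b ord K k) (hk : k < n)
    (ha : ∀ v < n, a v ≤ n) (hb : ∀ v < n, b v ≤ n) (hu : u < n)
    (huK : K u < n * (n + 1) + (n + 1)) (hmin : ∀ v < n, K u ≤ K v)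
    (hK' : ∀ v < n, K' v =
      newKey n m b (Function.update K u (n * (n + 1) + (n + 1))) k u v) :
    IsSearch n r a b (Function.update ord k u) (k + 1) ∧
      IsKeys n r a b (Function.update ord k u) K' (k + 1) := by
  have hun : ∀ j < k, ord j ≠ u := fun j hj e => by
    have := h.visited j hj
    rw [e] at this
    omega
  have ho : ∀ j < k, Function.update ord k u j = ord j := fun j hj =>
    Function.update_of_ne (by omega) _ _
  have hok : Function.update ord k u k = u := Function.update_self ..
  refine ⟨hs.extend hu hun fun v hv hvis hne => (h.unvisited u hu hun).precedes
    (h.unvisited v hv hvis) (hmin v hv) hk.le (hb v hv), ?_, ?_⟩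
  · intro j hj
    rcases Nat.lt_succ_iff_lt_or_eq.1 hj with hj | rfl
    · rw [ho j hj, hK' _ (hs.lt j hj), newKey, Function.update_of_ne (hun j hj), h.visited j hj]
      simp
    · rw [hok, hK' _ hu, newKey, Function.update_self]
      simp
  · intro v hv hne
    have hvu : v ≠ u := by
      have := hne k (by omega)
      rw [hok] at this
      exact this.symm
    have hvis : ∀ j < k, ord j ≠ v := fun j hj => by
      rw [← ho j hj]
      exact hne j (by omega)
    have hkey := h.unvisited v hv hvis
    have hlt := hkey.lt hk.le (ha v hv) (hb v hv)
    rw [hK' v hv, newKey, Function.update_of_ne hvu]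
    rcases hkey with ⟨h1, h2⟩ | ⟨j, hj, hjv, hjm, h2⟩
    · by_cases hruv : r u v
      · rw [if_pos ⟨hlt, by omega, (hr u v).1 hruv⟩]
        exact Or.inr ⟨k, by omega, by rwa [hok], fun i hi => by rw [ho i hi]; exact h1 i hi, rfl⟩
      · rw [if_neg fun h => hruv ((hr u v).2 h.2.2)]
        refine Or.inl ⟨fun j hj => ?_, h2⟩
        rcases Nat.lt_succ_iff_lt_or_eq.1 hj with hj | rfl
        · rw [ho j hj]; exact h1 j hj
        · rwa [hok]
    -- A key with an earlier first neighbour is below `n * (n + 1)`, so the update leaves it alone.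
    · have : (j + 1) * (n + 1) ≤ n * (n + 1) := Nat.mul_le_mul_right _ (by omega)
      have hbv := hb v hv
      rw [if_neg (by rintro ⟨-, h, -⟩; nlinarith)]
      exact Or.inr ⟨j, by omega, by rwa [ho j hj],
        fun i hi => by rw [ho i (by omega)]; exact hjm i hi, h2⟩

theorem runs_sweep {b : ℕ} (hb5 : b ≠ 5) (hb6 : b ≠ 6) (hr : ∀ i j, r i j ↔ s.mem 0 (i * n + j) < 2)
    (hW : 8 * (n + 2) ^ 2 ≤ W) (hn : s.reg 0 = n) (hm : ∀ c, s.mem 0 c ≤ 2)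
    (ha : ∀ v < n, s.mem 4 v ≤ n) (hb : ∀ v < n, s.mem b v ≤ n) :
    Runs W (sweep b) s (fun t s' => t ≤ 100 * (n + 1) ^ 2 ∧ s'.reg 0 = n ∧
      (∀ c, c ≠ 5 → c ≠ 6 → s'.mem c = s.mem c) ∧
      IsSearch n r (s.mem 4) (s.mem b) (s'.mem 6) n) := by
  have hW' : 8 * (n * n) + 32 * n + 32 ≤ W := by nlinarith
  have hnn : n * (n + 1) = n * n + n := by ring
  simp only [sweep, Runs.seq_iff, Runs.assign_iff]
  refine ⟨by simp [hn]; omega, by simp [hn]; omega, ?_⟩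
  refine Runs.mono (runs_initKeys (n := n) (κ := n * (n + 1)) (by omega) (by omega) (by simp [hn])
    (by simp [hn]) ha) ?_
  rintro t₁ s₁ ⟨ht₁, e0, e5, e6, em, eK⟩
  simp [hn] at e6
  -- Selection costs at most `20 n + 20`, the update `50 n + 50`, each of the two stores 3; the rest
  -- is slack.
  refine Runs.forLoop (n := n) (c := n * 70 + 90) (fun k s' => s'.reg 5 = n * (n + 1) ∧
    s'.reg 6 = n * (n + 1) + (n + 1) ∧ (∀ c, c ≠ 5 → c ≠ 6 → s'.mem c = s.mem c) ∧
    IsSearch n r (s.mem 4) (s.mem b) (s'.mem 6) k ∧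
    IsKeys n r (s.mem 4) (s.mem b) (s'.mem 6) (s'.mem 5) k) (by decide) (by omega) e0 ?_ ?_ ?_
  · refine ⟨by simp [e5], by simp [e6], fun c h5 _ => em c h5, ⟨?_, ?_, ?_⟩, ?_, ?_⟩
    · simp
    · simp
    · simp
    · simp
    · exact fun v hv _ => Or.inl ⟨by simp, eK v hv⟩
  · rintro k hk s₂ f1 f0 ⟨f5, f6, fm, fS, fK⟩
    have hle : ∀ v < n, s₂.mem 5 v ≤ n * (n + 1) + (n + 1) := fun v hv => fK.le hk.le ha hb hv
    obtain ⟨v, hv, hvis⟩ := exists_unvisited (s₂.mem 6) hk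
    simp only [Runs.seq_iff, Runs.store_iff]
    refine (runs_selectMin (W := W) (n := n) (β := n * (n + 1) + (n + 1)) (by omega) (by omega) f0 f6 hle
      ⟨v, hv, (fK.unvisited v hv hvis).lt hk.le (ha v hv) (hb v hv)⟩).mono ?_
    rintro t₃ s₃ ⟨ht₃, g0, g1, g5, g6, gm, g4, gK, gmin⟩
    rw [f1] at g1
    rw [f5] at g5
    rw [f6] at g6
    have f0m := fm 0 (by decide) (by decide)
    have fbm := fm b hb5 hb6
    refine ⟨by simp [g1]; omega, by simp [g6]; omega, ?_⟩
    refine (runs_updateKeys (W := W) (n := n) (k := k) (u := s₃.reg 4) hb5 hW (by simp [g0]) (by simp [g1])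
      hk (by simp) g4 (by simp [g5]) (by simp [g6]) (by simp [gm, f0m, hm]) ?_ ?_).mono ?_
    · simpa [hb5, hb6, gm, fbm] using hb
    · intro v hv
      have := hle v hv
      simp [gm, g6]
      split_ifs <;> omega
    rintro t₄ s₄ ⟨ht₄, k0, k1, k5, k6, km, kK⟩
    simp [g1, g6, gm, hb5, hb6, f0m, fbm] at kK km k5 k6
    have hstep := IsKeys.step (K' := s₄.mem 5) hr fS fK hk ha hb g4 gK gmin (by
      intro v hv
      rw [kK v hv])
    have k6m : s₄.mem 6 = Function.update (s₂.mem 6) k (s₃.reg 4) := by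
      rw [km 6 (by decide)]
      ext x
      simp [Function.update_apply]
    refine ⟨by simp; omega, k1, k0, by simp [k5, g5], by simp [k6], ?_, ?_⟩
    · intro c h5 h6
      simp [km c h5, h5, h6, fm c h5 h6]
    · simp only [k6m]
      exact hstep
  · rintro t s' ht - h0 ⟨-, -, h3, h4, -⟩
    refine ⟨?_, h0, h3, h4⟩
    simp only [Expr.cost]
    nlinarith

end

/-! ### Programs: recognition -/

/-- Adjacency (or equality) according to the matrix `m`. -/
def Near (n : ℕ) (m : ℕ → ℕ) (u v : ℕ) : Prop := m (u * n + v) < 2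

instance (n : ℕ) (m : ℕ → ℕ) : DecidableRel (Near n m) := fun _ _ => Nat.decLt _ _

/-- The degree of a vertex (the vertex itself is counted). -/
def deg (n : ℕ) (m : ℕ → ℕ) (v : ℕ) : ℕ := ((Finset.range n).filter (Near n m v)).card

/-- Store the degrees in array `2` and the codegrees in array `3`. -/
def degrees : Prog :=
  forLoop 1 <|
    .seq (.assign 3 (.const 0)) <|
    .seq (forLoop 2 (.cond (entryE (.var 1) (.var 2)) (.const 2)
      (.assign 3 (.add (.var 3) (.const 1))) skip)) <|
    .seq (.store 2 (.var 1) (.var 3)) <|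
    .store 3 (.var 1) (.sub (.var 0) (.var 3))

/-- Store in array `6` the order of the second of two successive sweeps. -/
def order : Prog :=
  .seq degrees <|
  .seq (sweep 3) <|
  .seq (forLoop 1 (.store 4 (.read 6 (.var 1)) (.sub (.var 0) (.var 1)))) <|
  sweep 2

/-- The matrix entry of the vertices with numbers `e₁` and `e₂` in the order in array `6`. -/
def ordEntryE (e₁ e₂ : Expr) : Expr := entryE (.read 6 e₁) (.read 6 e₂)

/-- Check whether the order in array `6` is an umbrella order. -/
def check : Prog :=
  .seq (.assign 7 (.const 1)) <|
  .seq (forLoop 1 <| forLoop 2 <|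
    .cond (.add (.var 1) (.const 1)) (.var 2)
      (.cond (ordEntryE (.var 1) (.var 2)) (.const 2)
        (.seq (.cond (ordEntryE (.var 1) (.sub (.var 2) (.const 1))) (.const 2) skip
            (.assign 7 (.const 0)))
          (.cond (ordEntryE (.add (.var 1) (.const 1)) (.var 2)) (.const 2) skip
            (.assign 7 (.const 0)))) skip) skip) <|
  .assign 0 (.var 7)

section

variable {W n : ℕ} {s : State}

attribute [local simp] Runs.assign_iff Runs.store_iff Runs.seq_iff Runs.cond_iff Expr.Fits
  Expr.eval Expr.cost entryE skip Function.update_apply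

theorem deg_le (n : ℕ) (m : ℕ → ℕ) (v : ℕ) : deg n m v ≤ n :=
  (Finset.card_filter_le _ _).trans (by simp)

theorem runs_degrees (hW : 8 * (n + 2) ^ 2 ≤ W) (hn : s.reg 0 = n) (hm : ∀ c, s.mem 0 c ≤ 2) :
    Runs W degrees s (fun t s' => t ≤ 50 * (n + 1) ^ 2 ∧ s'.reg 0 = n ∧
      (∀ c, c ≠ 2 → c ≠ 3 → s'.mem c = s.mem c) ∧
      (∀ v < n, s'.mem 2 v = deg n (s.mem 0) v) ∧
      ∀ v < n, s'.mem 3 v = n - deg n (s.mem 0) v) := by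
  have hW' : 8 * (n * n) + 32 * n + 32 ≤ W := by nlinarith
  refine Runs.forLoop (n := n) (c := n * 25 + 30) (fun k s' =>
    (∀ c, c ≠ 2 → c ≠ 3 → s'.mem c = s.mem c) ∧ (∀ v < k, s'.mem 2 v = deg n (s.mem 0) v) ∧
      ∀ v < k, s'.mem 3 v = n - deg n (s.mem 0) v) (by decide) (by omega) hn ?_ ?_ ?_
  · simp
  · rintro k hk s₁ e1 e0 ⟨em, e2, e3⟩
    simp only [Runs.seq_iff, Runs.assign_iff]
    refine ⟨by simp; omega, ?_⟩
    refine Runs.forLoop (n := n) (c := 15) (fun l s' => s'.reg 1 = k ∧ s'.mem = s₁.mem ∧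
      s'.reg 3 = ((Finset.range l).filter (Near n (s.mem 0) k)).card) (by decide) (by omega)
      (by simpa using e0) ?_ ?_ ?_
    · simp [e1]
    · rintro l hl s₂ f2 f0 ⟨f1, fm, f3⟩
      have hcell := cell_lt hk hl
      have hkn : k * n ≤ n * n := Nat.mul_le_mul_right _ hk.le
      have hml := hm (k * n + l)
      have em0 := em 0 (by decide) (by decide)
      have hle : ((Finset.range l).filter (Near n (s.mem 0) k)).card ≤ l :=
        (Finset.card_filter_le _ _).trans (by simp)
      simp [f0, f1, f2, f3, fm, em0]
      refine ⟨by omega, fun h => ⟨by omega, ?_⟩, fun h => ⟨by omega, ?_⟩⟩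
      · have : Near n (s.mem 0) k l := by simp only [Near]; omega
        rw [Finset.range_add_one, Finset.filter_insert, if_pos this,
          Finset.card_insert_of_notMem (by simp)]
      · have : ¬ Near n (s.mem 0) k l := by simp only [Near]; omega
        rw [Finset.range_add_one, Finset.filter_insert, if_neg this]
    · rintro t s₂ ht - f0 ⟨f1, fm, f3⟩
      have hle := deg_le n (s.mem 0) k
      change _ = deg n (s.mem 0) k at f3
      simp [f0, f1, f3, fm]
      refine ⟨by omega, by omega, by omega, ?_, ?_, ?_⟩
      · intro c h2 h3
        simp [h2, h3, em c h2 h3]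
      · intro v hv
        split_ifs with h
        · rw [h]
        · exact e2 v (by omega)
      · intro v hv
        split_ifs with h
        · rw [h]
        · exact e3 v (by omega)
  · rintro t s' ht - h0 ⟨h1, h2, h3⟩
    exact ⟨by nlinarith, h0, h1, h2, h3⟩

/-- The second sweep overwrites the first order, which is therefore only asserted to exist; the link
between the sweeps is `a' (ord i) = n - i`. -/
theorem runs_order (hW : 8 * (n + 2) ^ 2 ≤ W) (hn : s.reg 0 = n) (hm : ∀ c, s.mem 0 c ≤ 2)
    (ha : ∀ v < n, s.mem 4 v ≤ n) :
    Runs W order s (fun t s' => t ≤ 300 * (n + 1) ^ 2 ∧ s'.reg 0 = n ∧ s'.mem 0 = s.mem 0 ∧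
      ∃ ord : ℕ → ℕ, ∃ a a' b d : ℕ → ℕ, IsSearch n (Near n (s.mem 0)) a b ord n ∧
        IsSearch n (Near n (s.mem 0)) a' d (s'.mem 6) n ∧
        (∀ v < n, d v = deg n (s.mem 0) v) ∧ (∀ v < n, b v = n - deg n (s.mem 0) v) ∧
        ∀ i < n, a' (ord i) = n - i) := by
  have hW' : 8 * (n * n) + 32 * n + 32 ≤ W := by nlinarith
  simp only [order, Runs.seq_iff]
  refine (runs_degrees (W := W) hW hn hm).mono ?_
  rintro t₁ s₁ ⟨ht₁, e0, em, e2, e3⟩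
  have em0 := em 0 (by decide) (by decide)
  have em4 := em 4 (by decide) (by decide)
  refine (runs_sweep (W := W) (r := Near n (s.mem 0)) (by decide) (by decide)
    (fun i j => by rw [em0]; rfl) hW e0 (by rwa [em0]) (by rwa [em4])
    (fun v hv => by rw [e3 v hv]; omega)).mono ?_
  rintro t₂ s₂ ⟨ht₂, f0, fm, fS⟩
  have fm0 := fm 0 (by decide) (by decide)
  have fm2 := fm 2 (by decide) (by decide)
  refine Runs.forLoop (n := n) (c := 20) (fun k s' => (∀ c, c ≠ 4 → s'.mem c = s₂.mem c) ∧
    ∀ i < k, s'.mem 4 (s₂.mem 6 i) = n - i) (by decide) (by omega) f0 ?_ ?_ ?_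
  · simp
  · rintro k hk s₃ g1 g0 ⟨gm, g4⟩
    have gm6 := gm 6 (by decide)
    have hlt := fS.lt k hk
    simp [g0, g1, gm6]
    refine ⟨by omega, fun c hc => by simp [hc, gm c hc], fun i hi => ?_⟩
    split_ifs with h
    · rw [fS.inj i (by omega) k hk h]
    · exact g4 i (lt_of_le_of_ne hi fun e => h (by rw [e]))
  rintro t₃ s₃ ht₃ - g0 ⟨gm, g4⟩
  have gm0 := gm 0 (by decide)
  have gm2 := gm 2 (by decide)
  -- The loop wrote to cells addressed through the first order; as that order is a permutation,
  -- every cell below `n` was written.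
  have ha' : ∀ v < n, s₃.mem 4 v ≤ n := by
    intro v hv
    obtain ⟨σ, hσ, -⟩ := fS.exists_sweep
    have := g4 (σ ⟨v, hv⟩) (σ ⟨v, hv⟩).2
    rw [← hσ] at this
    simp at this
    omega
  refine (runs_sweep (W := W) (r := Near n (s.mem 0)) (by decide) (by decide)
    (fun i j => by rw [gm0, fm0, em0]; rfl) hW g0 (by rwa [gm0, fm0, em0]) ha'
    (fun v hv => by rw [gm2, fm2, e2 v hv]; exact deg_le ..)).mono ?_
  rintro t₄ s₄ ⟨ht₄, k0, km, kS⟩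
  refine ⟨by nlinarith, k0, by rw [km 0 (by decide) (by decide), gm0, fm0, em0],
    _, _, _, _, _, fS, kS, fun v hv => by rw [gm2, fm2, e2 v hv], e3, g4⟩

/-- The local condition that is tested by `check`. -/
def LocallyUmbrella (r : ℕ → ℕ → Prop) (i k : ℕ) : Prop :=
  i + 1 < k → r i k → r i (k - 1) ∧ r (i + 1) k

theorem runs_check {ord m : ℕ → ℕ} (hW : 8 * (n + 2) ^ 2 ≤ W) (hn : s.reg 0 = n)
    (hm0 : s.mem 0 = m) (h6 : s.mem 6 = ord) (hm : ∀ c, m c ≤ 2) (hlt : ∀ i < n, ord i < n) :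
    Runs W check s (fun t s' => t ≤ 100 * (n + 1) ^ 2 ∧ s'.reg 0 ≤ 1 ∧ (s'.reg 0 = 1 ↔
      ∀ i < n, ∀ k < n, LocallyUmbrella (fun i j => Near n m (ord i) (ord j)) i k)) := by
  have hW' : 8 * (n * n) + 32 * n + 32 ≤ W := by nlinarith
  set r : ℕ → ℕ → Prop := fun i j => Near n m (ord i) (ord j) with hr
  have hcell : ∀ i < n, ∀ j < n, ord i < W ∧ ord j < W ∧ ord i * n < W ∧ ord i * n + ord j < W :=
    fun i hi j hj => by
      have h1 := cell_lt (hlt i hi) (hlt j hj)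
      have h2 := hlt i hi
      have h3 := hlt j hj
      omega
  simp only [check, Runs.seq_iff, Runs.assign_iff]
  refine ⟨by simp; omega, ?_⟩
  -- The flag in register `7` is never raised again, so it records the conjunction of all tests so
  -- far. The cost is that of the inner loop with body bound 73.
  refine Runs.forLoop (n := n) (c := n * 80 + 5) (fun i s' => s'.mem = s.mem ∧ s'.reg 7 ≤ 1 ∧
    (s'.reg 7 = 1 ↔ ∀ i' < i, ∀ k < n, LocallyUmbrella r i' k)) (by decide) (by omega)
    (by simpa using hn) ?_ ?_ ?_
  · simp
  · rintro i hi s₁ e1 e0 ⟨em, e7, e7'⟩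
    refine Runs.forLoop (n := n) (c := 73) (fun k s' => s'.reg 1 = i ∧ s'.mem = s.mem ∧
      s'.reg 7 ≤ 1 ∧ (s'.reg 7 = 1 ↔ (∀ i' < i, ∀ k < n, LocallyUmbrella r i' k) ∧
        ∀ k' < k, LocallyUmbrella r i k')) (by decide) (by omega) e0 ?_ ?_ ?_
    · simp [e1, em, e7, e7']
    · rintro k hk s₂ f2 f0 ⟨f1, fm, f7, f7'⟩
      have hsplit : (∀ k' ≤ k, LocallyUmbrella r i k') ↔
          (∀ k' < k, LocallyUmbrella r i k') ∧ LocallyUmbrella r i k :=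
        ⟨fun h => ⟨fun k' hk' => h k' hk'.le, h k le_rfl⟩,
          fun h k' hk' => hk'.lt_or_eq.elim (h.1 k') fun e => e ▸ h.2⟩
      have c1 := hcell i hi k hk
      have c2 := hcell i hi (k - 1) (by omega)
      have hmm : ∀ c, m c < W := fun c => (hm c).trans_lt (by omega)
      have hw : 0 < W ∧ 1 < W ∧ 2 < W ∧ n < W ∧ i < W ∧ k < W ∧ i + 1 < W := by omega
      have hL : LocallyUmbrella r i k ↔ (i + 1 < k → m (ord i * n + ord k) ≤ 1 →
          m (ord i * n + ord (k - 1)) ≤ 1 ∧ m (ord (i + 1) * n + ord k) ≤ 1) := by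
        simp only [← Nat.lt_succ_iff]
        rfl
      by_cases h : i + 1 < k
      · have c3 := hcell (i + 1) (by omega) k hk
        by_cases p1 : m (ord i * n + ord k) ≤ 1 <;>
        by_cases p2 : m (ord i * n + ord (k - 1)) ≤ 1 <;>
        by_cases p3 : m (ord (i + 1) * n + ord k) ≤ 1 <;>
        simp [ordEntryE, f0, f1, f2, fm, hm0, h6, hmm, c1, c2, c3, hw, h, p1, p2, p3, f7, f7',
          hsplit, hL]
      · simp [f0, f1, f2, fm, hw, h, f7, f7', hsplit, hL]
    · rintro t s₂ ht - f0 ⟨f1, fm, f7, f7'⟩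
      simp [f1, fm, f0, f7, f7']
      refine ⟨by omega, fun h i' hi' => ?_, fun h => ⟨fun i' hi' => h i' hi'.le, h i le_rfl⟩⟩
      rcases hi'.lt_or_eq with hi' | rfl
      · exact h.1 i' hi'
      · exact h.2
  · rintro t s₁ ht - f0 ⟨fm, f7, f7'⟩
    simp [f7, f7']
    refine ⟨by omega, by nlinarith⟩

end

/-! ### Programs: coordinates -/

/-- Compute the forest of an umbrella order (parents in array `7`, subtree sizes in array `8`) and
from it the coordinates (array `9` for the nodes of the forest, array `1` for the vertices). -/
def layout : Prog :=
  .seq (forLoop 1 <|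
    .seq (.assign 3 (.const 0)) <|
    .seq (forLoop 2 (.cond (.var 2) (.var 1)
      (.cond (ordEntryE (.var 2) (.var 1)) (.const 2) skip
        (.assign 3 (.add (.var 3) (.const 1)))) skip)) <|
    .seq (.store 7 (.add (.var 1) (.const 1)) (.var 3)) <|
    .store 8 (.var 1) (.const 1)) <|
  .seq (.store 7 (.const 0) (.const 0)) <|
  .seq (.store 8 (.var 0) (.const 1)) <|
  .seq (forLoop 1 <|
    .seq (.assign 3 (.sub (.var 0) (.var 1))) <|
    .store 8 (.read 7 (.var 3)) (.add (.read 8 (.read 7 (.var 3))) (.read 8 (.var 3)))) <|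
  .seq (.store 9 (.const 0) (.const 0)) <|
  forLoop 1 <|
    .seq (.cond (.read 7 (.var 1)) (.read 7 (.add (.var 1) (.const 1)))
      (.assign 3 (.add (.read 9 (.read 7 (.add (.var 1) (.const 1)))) (.add (.var 0) (.const 1))))
      (.assign 3 (.add (.read 9 (.var 1)) (.read 8 (.var 1))))) <|
    .seq (.store 9 (.add (.var 1) (.const 1)) (.var 3)) <|
    .store 1 (.read 6 (.var 1)) (.var 3)

/-- The number of vertices before the vertex with number `i` that are not adjacent to it. -/
def gap (n : ℕ) (m ord : ℕ → ℕ) (i : ℕ) : ℕ :=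
  ((Finset.range i).filter (fun j => ¬ Near n m (ord j) (ord i))).card

theorem gap_le (n : ℕ) (m ord : ℕ → ℕ) (i : ℕ) : gap n m ord i ≤ i :=
  (Finset.card_filter_le _ _).trans (by simp)

/-- Subtree sizes after the nodes `n, …, n - k + 1` have been processed. -/
structure IsSizes (n : ℕ) (q z : ℕ → ℕ) (k : ℕ) : Prop where
  size : ∀ j ≤ n, z j = 1 + ∑ i ∈ Finset.Icc (n - k + 1) n with q i = j, z i
  total : ∑ j ∈ Finset.range (n - k + 1), z j = n + 1
  le : ∀ j ≤ n, z j ≤ n + 1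

/-- Node `n - k` passes its size to its parent, of smaller index: sizes from `n - k` on are final
and the total over the smaller nodes is preserved. This total bounds the updated entry, and at the
end it is the size of the root. -/
theorem IsSizes.step {n k : ℕ} {q z : ℕ → ℕ} (h : IsSizes n q z k) (hk : k < n)
    (hq : q (n - k) < n - k) :
    IsSizes n q (Function.update z (q (n - k)) (z (q (n - k)) + z (n - k))) (k + 1) := by
  obtain ⟨i, hi⟩ : ∃ i, i = n - k := ⟨_, rfl⟩
  have e1 : n - (k + 1) + 1 = i := by omega
  obtain ⟨h1, h2, h3⟩ := h
  rw [← hi] at hq ⊢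
  replace h1 : ∀ j ≤ n, z j = 1 + ∑ x ∈ Finset.Icc (i + 1) n with q x = j, z x := hi ▸ h1
  replace h2 : ∑ j ∈ Finset.range (i + 1), z j = n + 1 := hi ▸ h2
  have hz : ∀ x, i ≤ x → Function.update z (q i) (z (q i) + z i) x = z x := fun x hx =>
    Function.update_of_ne (by omega) _ _
  have htot : ∑ j ∈ Finset.range i, Function.update z (q i) (z (q i) + z i) j = n + 1 := by
    rw [Finset.sum_update_of_mem (Finset.mem_range.2 hq), ← h2, Finset.sum_range_succ,
      Finset.sum_eq_add_sum_sdiff_singleton_of_mem (Finset.mem_range.2 hq) z]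
    ring
  refine ⟨fun j hj => ?_, by rwa [e1], fun j hj => ?_⟩
  · have hins : Finset.Icc i n = insert i (Finset.Icc (i + 1) n) := by
      ext x; simp; omega
    have hni : i ∉ (Finset.Icc (i + 1) n).filter (fun x => q x = j) := by simp
    have hsum : ∑ x ∈ Finset.Icc (i + 1) n with q x = j,
        Function.update z (q i) (z (q i) + z i) x = ∑ x ∈ Finset.Icc (i + 1) n with q x = j, z x :=
      Finset.sum_congr rfl fun x hx => hz x (by simp at hx; omega)
    rw [e1, hins, Finset.filter_insert]
    by_cases hj' : q i = j
    · subst hj'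
      rw [if_pos rfl, Finset.sum_insert hni, hsum, hz i le_rfl, Function.update_self]
      have := h1 (q i) hj
      omega
    · rw [if_neg hj', hsum, Function.update_of_ne (Ne.symm hj')]
      exact h1 j hj
  · by_cases hj' : j = q i
    · rw [← htot]
      exact Finset.single_le_sum (f := Function.update z (q i) (z (q i) + z i))
        (fun _ _ => Nat.zero_le _) (Finset.mem_range.2 (hj' ▸ hq))
    · rw [Function.update_of_ne hj']
      exact h3 j hj

section

variable {W n : ℕ} {s : State}

attribute [local simp] Runs.assign_iff Runs.store_iff Runs.seq_iff Runs.cond_iff Expr.Fits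
  Expr.eval Expr.cost entryE skip Function.update_apply

theorem runs_layout {ord m : ℕ → ℕ} (hW : 8 * (n + 2) ^ 2 ≤ W) (hn : s.reg 0 = n)
    (hm0 : s.mem 0 = m) (h6 : s.mem 6 = ord) (hm : ∀ c, m c ≤ 2) (hlt : ∀ i < n, ord i < n)
    (hinj : ∀ i < n, ∀ j < n, ord i = ord j → i = j)
    (hmono : ∀ i, i + 1 < n → gap n m ord i ≤ gap n m ord (i + 1)) :
    Runs W layout s (fun t s' => t ≤ 200 * (n + 1) ^ 2 ∧ ∃ q z E, IsLayout n q z E ∧ q 0 = 0 ∧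
      (∀ i < n, q (i + 1) = gap n m ord i) ∧ ∀ i < n, s'.mem 1 (ord i) = E (i + 1)) := by
  have hW' : 8 * (n * n) + 32 * n + 32 ≤ W := by nlinarith
  have hmm : ∀ c, m c < W := fun c => (hm c).trans_lt (by omega)
  simp only [layout, Runs.seq_iff]
  refine Runs.forLoop (n := n) (c := n * 50 + 40) (fun k s' => s'.mem 0 = m ∧ s'.mem 6 = ord ∧
    (∀ i < k, s'.mem 7 (i + 1) = gap n m ord i) ∧ ∀ i < k, s'.mem 8 i = 1)
    (by decide) (by omega) hn ?_ ?_ ?_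
  · simp [hm0, h6]
  · rintro k hk s₁ e1 e0 ⟨em0, em6, e7, e8⟩
    simp only [Runs.seq_iff, Runs.assign_iff]
    refine ⟨by simp; omega, ?_⟩
    refine Runs.forLoop (n := n) (c := 30) (fun l s' => s'.reg 1 = k ∧ s'.mem = s₁.mem ∧
      s'.reg 3 = ((Finset.range (min l k)).filter (fun j => ¬ Near n m (ord j) (ord k))).card)
      (by decide) (by omega) (by simpa using e0) ?_ ?_ ?_
    · simp [e1]
    · rintro l hl s₂ f2 f0 ⟨f1, fm, f3⟩
      have hcell := cell_lt (hlt l hl) (hlt k hk)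
      have h1 := hlt l hl
      have h2 := hlt k hk
      have hle : ((Finset.range (min l k)).filter (fun j => ¬ Near n m (ord j) (ord k))).card ≤ l :=
        (Finset.card_filter_le _ _).trans (by simp)
      have hw : 0 < W ∧ 1 < W ∧ 2 < W ∧ n < W ∧ l < W ∧ k < W ∧ ord l < W ∧ ord k < W ∧
        ord l * n < W ∧ ord l * n + ord k < W ∧ s₂.reg 3 < W ∧ s₂.reg 3 + 1 < W := by omega
      by_cases hlk : l < k
      · rw [min_eq_left hlk.le] at f3
        by_cases hnear : m (ord l * n + ord k) < 2
        · have : Near n m (ord l) (ord k) := hnear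
          simp [ordEntryE, f0, f1, f2, fm, em0, em6, hmm, hw, hlk, hnear]
          rw [f3, Finset.range_add_one, Finset.filter_insert, if_neg (not_not.2 this)]
        · have : ¬ Near n m (ord l) (ord k) := hnear
          simp [ordEntryE, f0, f1, f2, fm, em0, em6, hmm, hw, hlk, hnear]
          rw [f3, Finset.range_add_one, Finset.filter_insert, if_pos this, Finset.card_insert_of_notMem (by simp)]
      · simp [f0, f1, f2, fm, hw, hlk]
        rw [f3, min_eq_right (by omega), min_eq_right (by omega)]
    · rintro t s₂ ht - f0 ⟨f1, fm, f3⟩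
      rw [min_eq_right hk.le] at f3
      change _ = gap n m ord k at f3
      have := gap_le n m ord k
      simp [f0, f1, f3, fm, em0, em6]
      refine ⟨by omega, by omega, by omega, fun i hi => ?_, fun i hi => ?_⟩
      · split_ifs with h
        · rw [h]
        · exact e7 i (by omega)
      · exact fun h => e8 i (by omega)
  rintro t₁ s₁ ht₁ - e0 ⟨em0, em6, e7, e8⟩
  simp only [Runs.store_iff]
  refine ⟨by simp; omega, ?_⟩
  refine ⟨by simp [e0]; omega, ?_⟩
  -- Node `i + 1` stands for the vertex at position `i`; node `0` is the extra root, its own parent.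
  obtain ⟨q, hq⟩ : ∃ q : ℕ → ℕ, q = Function.update (s₁.mem 7) 0 0 := ⟨_, rfl⟩
  have hq0 : q 0 = 0 := by simp [hq]
  have hqs : ∀ i < n, q (i + 1) = gap n m ord i := fun i hi => by simp [hq, e7 i hi]
  have hqlt : ∀ i, 1 ≤ i → i ≤ n → q i < i := fun i h1 h2 => by
    obtain ⟨i, rfl⟩ := Nat.exists_eq_add_of_le' h1
    rw [hqs i h2]
    exact Nat.lt_succ_of_le (gap_le ..)
  have hqmono : ∀ i < n, q i ≤ q (i + 1) := fun i hi => by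
    cases i with
    | zero => rw [hq0]; exact Nat.zero_le _
    | succ i =>
      rw [hqs i (by omega), hqs (i + 1) hi]
      exact hmono i hi
  refine Runs.forLoop (n := n) (c := 40) (fun k s' => s'.mem 6 = ord ∧ s'.mem 7 = q ∧
    IsSizes n q (s'.mem 8) k) (by decide) (by omega) (by simp [e0]) ?_ ?_ ?_
  · refine ⟨by simp [em6], by simp [hq], ?_⟩
    have hz : ∀ j ≤ n, Function.update (s₁.mem 8) n 1 j = 1 := fun j hj => by
      by_cases h : j = n
      · simp [h]
      · simp [h, e8 j (by omega)]
    simp [e0]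
    refine ⟨fun j hj => ?_, ?_, fun j hj => ?_⟩
    · rw [hz j hj]
      simp
    · rw [Nat.sub_zero, Finset.sum_congr rfl fun j hj => hz j (by simp at hj; omega)]
      simp
    · rw [hz j hj]; omega
  · rintro k hk s₂ f1 f0 ⟨f6, f7, fz⟩
    have hlt' := hqlt (n - k) (by omega) (by omega)
    have hstep := fz.step hk hlt'
    have b1 := fz.le (n - k) (by omega)
    have b2 := fz.le (q (n - k)) (by omega)
    simp [f0, f1, f6, f7]
    exact ⟨by omega, by omega, hstep⟩
  rintro t₂ s₂ ht₂ - f0 ⟨f6, f7, fz⟩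
  refine ⟨by simp; omega, ?_⟩
  obtain ⟨z, hz⟩ : ∃ z, z = s₂.mem 8 := ⟨_, rfl⟩
  rw [← hz] at fz
  refine Runs.forLoop (n := n) (c := 40) (fun k s' => s'.mem 6 = ord ∧ s'.mem 7 = q ∧
    s'.mem 8 = z ∧ s'.mem 9 0 = 0 ∧ (∀ i < k, s'.mem 9 (i + 1) = if q i < q (i + 1) then
      s'.mem 9 (q (i + 1)) + n + 1 else s'.mem 9 i + z i) ∧
    (∀ i ≤ k, s'.mem 9 i ≤ i * (n + 1)) ∧ ∀ i < k, s'.mem 1 (ord i) = s'.mem 9 (i + 1))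
    (by decide) (by omega) (by simpa using f0) ?_ ?_ ?_
  · simp [f6, f7, hz]
  · rintro k hk s₃ g1 g0 ⟨g6, g7, g8, g9, gE, gle, gout⟩
    have hlt' := hqlt (k + 1) (by omega) (by omega)
    have b1 := gle k le_rfl
    have b2 := gle (q (k + 1)) (by omega)
    have b3 : q (k + 1) * (n + 1) ≤ k * (n + 1) := Nat.mul_le_mul_right _ (by omega)
    have b4 : k * (n + 1) + (n + 1) ≤ n * n + n := by nlinarith
    have b5 := fz.le k hk.le
    have b6 := hlt k hk
    have b7 : q k ≤ k := by
      rcases Nat.eq_zero_or_pos k with rfl | h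
      · omega
      · exact (hqlt k h hk.le).le
    have b8 : (k + 1) * (n + 1) = k * (n + 1) + (n + 1) := by ring
    -- Writing cell `k + 1` keeps the earlier equations valid, since they, like the new right-hand
    -- side, read only cells up to `k`. A step adds at most `n + 1`, whence the quadratic bound.
    have key : ∀ e, (e = if q k < q (k + 1) then s₃.mem 9 (q (k + 1)) + (n + 1) else
        s₃.mem 9 k + z k) → ∀ E', E' = Function.update (s₃.mem 9) (k + 1) e →
        (E' 0 = 0 ∧ (∀ i ≤ k, E' (i + 1) = if q i < q (i + 1) then E' (q (i + 1)) + n + 1 else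
          E' i + z i) ∧ (∀ i ≤ k + 1, E' i ≤ i * (n + 1)) ∧
          ∀ i ≤ k, Function.update (s₃.mem 1) (ord k) e (ord i) = E' (i + 1)) := by
      rintro e he E' rfl
      have hE : ∀ i ≤ k, Function.update (s₃.mem 9) (k + 1) e i = s₃.mem 9 i := fun i hi =>
        Function.update_of_ne (by omega) _ _
      refine ⟨by rw [hE 0 (by omega), g9], fun i hi => ?_, fun i hi => ?_, fun i hi => ?_⟩
      · have := hqlt (i + 1) (by omega) (by omega)
        rw [hE i hi, hE (q (i + 1)) (by omega)]
        rcases hi.lt_or_eq with h | rfl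
        · rw [hE (i + 1) h, gE i h]
        · rw [Function.update_self, he]
          rfl
      · rcases hi.lt_or_eq with h | rfl
        · rw [hE i (by omega)]
          exact gle i (by omega)
        · rw [Function.update_self, he]
          split_ifs <;> omega
      · rcases hi.lt_or_eq with h | rfl
        · rw [Function.update_of_ne fun e => (by omega : i ≠ k) (hinj i (by omega) k hk e),
            hE (i + 1) h, gout i h]
        · simp
    obtain ⟨e, he⟩ : ∃ e, e = if q k < q (k + 1) then s₃.mem 9 (q (k + 1)) + (n + 1) else
        s₃.mem 9 k + z k := ⟨_, rfl⟩
    have heW : e < W := by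
      rw [he]
      split_ifs <;> omega
    have hcond : Runs W (.cond (.read 7 (.var 1)) (.read 7 (.add (.var 1) (.const 1)))
        (.assign 3 (.add (.read 9 (.read 7 (.add (.var 1) (.const 1)))) (.add (.var 0) (.const 1))))
        (.assign 3 (.add (.read 9 (.var 1)) (.read 8 (.var 1))))) s₃
        (fun t s' => t ≤ 20 ∧ s' = ⟨Function.update s₃.reg 3 e, s₃.mem⟩) := by
      by_cases h : q k < q (k + 1)
      · rw [if_pos h] at he
        simp [g0, g1, g7, h, ← he]
        omega
      · rw [if_neg h] at he
        simp [g0, g1, g7, g8, h, ← he]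
        omega
    rw [Runs.seq_iff]
    refine hcond.mono ?_
    rintro t s' ⟨ht, rfl⟩
    obtain ⟨k1, k2, k3, k4⟩ := key e he _ rfl
    simp only [Runs.seq_iff, Runs.store_iff]
    simp [g0, g1, g6, g7, g8]
    exact ⟨by omega, by omega, by omega, g9, by simpa using k2, by simpa using k3,
      by simpa using k4⟩
  · rintro t₃ s₃ ht₃ - - ⟨g6, g7, g8, g9, gE, -, gout⟩
    refine ⟨?_, q, z, s₃.mem 9, ⟨hqmono, hqlt, ?_, ?_, g9, gE⟩, hq0, hqs, gout⟩
    · simp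
      nlinarith
    · have := fz.size
      simpa using this
    · have := fz.total
      simpa using this

end

/-! ### Correctness of the algorithms -/

/-- The order `0, …, n - 1` is an umbrella order of `r`. -/
def IsUmbrellaOn (n : ℕ) (r : ℕ → ℕ → Prop) : Prop :=
  ∀ i j k, i ≤ j → j ≤ k → k < n → r i k → r i j ∧ r j k

/-- Shortening a related pair by one position at either end, repeatedly, reaches every vertex in
between; reflexivity covers the short pairs excluded by `i + 1 < k`. -/
theorem isUmbrellaOn_iff {n : ℕ} {r : ℕ → ℕ → Prop} (hr : ∀ i < n, r i i) :
    (∀ i < n, ∀ k < n, LocallyUmbrella r i k) ↔ IsUmbrellaOn n r := by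
  constructor
  · intro h
    have h1 : ∀ i k, k < n → r i k → ∀ j, i ≤ j → j ≤ k → r i j := by
      intro i k
      induction k with
      | zero =>
        intro hk hik j _ hj
        rwa [Nat.le_zero.1 hj]
      | succ k ih =>
        intro hk hik j hij hj
        rcases hj.lt_or_eq with hlt | rfl
        · rcases hij.lt_or_eq with hij' | rfl
          · exact ih (by omega) (h i (by omega) (k + 1) hk (by omega) hik).1 j hij (by omega)
          · exact hr _ (by omega)
        · exact hik
    have h2 : ∀ d i k, k = i + d → k < n → r i k → ∀ j, i ≤ j → j ≤ k → r j k := by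
      intro d
      induction d with
      | zero =>
        intro i k hk0 hk hik j hij hj
        rwa [show j = i by omega]
      | succ d ih =>
        rintro i k rfl hk hik j hij hj
        rcases hij.lt_or_eq with hlt | rfl
        · rcases hj.lt_or_eq with hj' | rfl
          · exact ih (i + 1) _ (by omega) hk (h i (by omega) _ hk (by omega) hik).2 j hlt hj
          · exact hr _ hk
        · exact hik
    exact fun i j k hij hjk hk hik =>
      ⟨h1 i k hk hik j hij hjk, h2 (k - i) i k (by omega) hk hik j hij hjk⟩
  · intro h i hi k hk hik hr'
    exact ⟨(h i (k - 1) k (by omega) (by omega) hk hr').1,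
      (h i (i + 1) k (by omega) (by omega) hk hr').2⟩

/-! ### The relation read off from the input matrix -/

section

variable {n : ℕ} {G : SignedGraph (Fin n)}

theorem _root_.SignedGraph.PosAdj.symm {V : Type*} {G : SignedGraph V} {u v : V}
    (h : G.PosAdj u v) : G.PosAdj v u := by
  unfold SignedGraph.PosAdj at *
  simp only [Sym2.eq_swap (a := v) (b := u)]
  exact h

theorem _root_.SignedGraph.not_posAdj_of_negAdj {V : Type*} {G : SignedGraph V} {u v : V}
    (h : G.NegAdj u v) : ¬ G.PosAdj u v := by
  rintro ⟨h1, h2⟩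
  obtain ⟨h3, h4⟩ := h
  rw [h2] at h4
  exact absurd h4 (by decide)

theorem _root_.SignedGraph.ne_of_negAdj {V : Type*} {G : SignedGraph V} {u v : V}
    (h : G.NegAdj u v) : u ≠ v := by
  obtain ⟨h, -⟩ := h
  exact G.graph.ne_of_adj h

theorem _root_.SignedGraph.IsComplete.posAdj_or_negAdj {V : Type*} {G : SignedGraph V}
    (hG : G.IsComplete) {u v : V} (h : u ≠ v) : G.PosAdj u v ∨ G.NegAdj u v := by
  have he : s(u, v) ∈ G.graph.edgeSet := by
    rw [SimpleGraph.mem_edgeSet, hG]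
    exact h
  rcases Int.units_eq_one_or (G.sign ⟨_, he⟩) with h1 | h1
  · exact Or.inl ⟨he, h1⟩
  · exact Or.inr ⟨he, h1⟩

theorem input_mem_le (G : SignedGraph (Fin n)) (a k : ℕ) : (input G).mem a k ≤ 2 := by
  unfold input SignedGraph.entry
  dsimp only
  split_ifs <;> omega

theorem input_mem_of_ne (G : SignedGraph (Fin n)) {a : ℕ} (ha : a ≠ 0) (k : ℕ) :
    (input G).mem a k = 0 := by
  simp [input, ha]

theorem input_mem_cell (G : SignedGraph (Fin n)) (u v : Fin n) :
    (input G).mem 0 (u * n + v) = G.entry u v := by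
  have hn : 0 < n := u.pos
  have h1 : ((u : ℕ) * n + v) / n = u := by
    rw [Nat.mul_comm, Nat.mul_add_div hn, Nat.div_eq_of_lt v.2, add_zero]
  have h2 : ((u : ℕ) * n + v) % n = v := by
    rw [Nat.mul_comm, Nat.mul_add_mod, Nat.mod_eq_of_lt v.2]
  have hd : (Fin.divNat ⟨u * n + v, cell_lt u.2 v.2⟩ : Fin n) = u := Fin.ext h1
  have hm : (Fin.modNat ⟨u * n + v, cell_lt u.2 v.2⟩ : Fin n) = v := Fin.ext h2
  rw [input]
  dsimp only
  rw [dif_pos ⟨rfl, cell_lt u.2 v.2⟩, hd, hm]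

/-- Entries below 2 are positive edges and non-edges; by completeness the latter occur only on the
diagonal. -/
theorem near_iff (hG : G.IsComplete) (u v : Fin n) :
    Near n ((input G).mem 0) u v ↔ u = v ∨ G.PosAdj u v := by
  rw [Near, input_mem_cell, SignedGraph.entry]
  split_ifs with h1 h2
  · simp [h1]
  · simp [h1, SignedGraph.ne_of_negAdj h2]
  · have : u = v := by
      by_contra h
      exact (hG.posAdj_or_negAdj h).elim h1 h2
    simp [this]

theorem near_refl (hG : G.IsComplete) {i : ℕ} (hi : i < n) : Near n ((input G).mem 0) i i :=
  (near_iff hG ⟨i, hi⟩ ⟨i, hi⟩).2 (Or.inl rfl)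

theorem near_symm (hG : G.IsComplete) {i j : ℕ} (hi : i < n) (hj : j < n)
    (h : Near n ((input G).mem 0) i j) : Near n ((input G).mem 0) j i :=
  (near_iff hG ⟨j, hj⟩ ⟨i, hi⟩).2 (((near_iff hG ⟨i, hi⟩ ⟨j, hj⟩).1 h).imp Eq.symm (·.symm))

theorem isUmbrella_of_drawing (hG : G.IsComplete) {D : Fin n → ℝ} (hD : G.IsValidDrawing D) :
    IsUmbrella (fun u v : Fin n => Near n ((input G).mem 0) u v) D := by
  intro u v w huv hvw huw
  simp only [near_iff hG] at huw ⊢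
  rcases huw with rfl | huw
  · obtain rfl := hD.1 (le_antisymm huv hvw)
    simp
  · have aux : ∀ x y : Fin n, G.PosAdj x y → dist (D x) (D v) ≤ dist (D x) (D y) →
        x = v ∨ G.PosAdj x v := by
      intro x y hxy hle
      by_cases h : x = v
      · exact Or.inl h
      · rcases hG.posAdj_or_negAdj h with h | h
        · exact Or.inr h
        · exact absurd (hD.2 x y v hxy h) (not_lt.2 hle)
    refine ⟨aux u w huw ?_, (aux w u huw.symm ?_).imp Eq.symm (·.symm)⟩
    · rw [dist_comm, Real.dist_eq, dist_comm, Real.dist_eq, abs_of_nonneg, abs_of_nonneg] <;>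
        linarith
    · rw [Real.dist_eq, Real.dist_eq, abs_of_nonneg, abs_of_nonneg] <;> linarith

theorem deg_eq_ncard (m : ℕ → ℕ) (v : Fin n) :
    deg n m v = {w : Fin n | Near n m v w}.ncard := by
  rw [← Set.ncard_image_of_injective _ Fin.val_injective, deg, ← Set.ncard_coe_finset]
  congr 1
  ext x
  simp only [Finset.coe_filter, Finset.mem_range, Set.mem_ofPred_eq, Set.mem_image]
  exact ⟨fun h => ⟨⟨x, h.1⟩, h.2, rfl⟩, by rintro ⟨w, hw, rfl⟩; exact ⟨w.2, hw⟩⟩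

theorem isUmbrellaOn_of_search (hG : G.IsComplete) (hD : G.HasLineDrawing)
    {ord ord' a a' b d : ℕ → ℕ} (h₁ : IsSearch n (Near n ((input G).mem 0)) a b ord n)
    (h₂ : IsSearch n (Near n ((input G).mem 0)) a' d ord' n)
    (hd : ∀ v < n, d v = deg n ((input G).mem 0) v)
    (hb : ∀ v < n, b v = n - deg n ((input G).mem 0) v) (ha' : ∀ i < n, a' (ord i) = n - i) :
    IsUmbrellaOn n (fun i j => Near n ((input G).mem 0) (ord' i) (ord' j)) := by
  obtain ⟨D, hD⟩ := hD
  obtain ⟨σ, hσ, h₁⟩ := h₁.exists_sweep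
  obtain ⟨τ, hτ, h₂⟩ := h₂.exists_sweep
  have e1 : (fun v : Fin n => b v) = fun v : Fin n => n - deg n ((input G).mem 0) v :=
    funext fun v => hb v v.2
  have e2 : (fun v : Fin n => d v) = fun v : Fin n => deg n ((input G).mem 0) v :=
    funext fun v => hd v v.2
  have e3 : (fun v : Fin n => a' v) = fun v : Fin n => n - (σ v : ℕ) := funext fun v => by
    rw [← ha' (σ v) (σ v).2, ← hσ, Equiv.symm_apply_apply]
  rw [e1] at h₁
  rw [e2, e3] at h₂
  have := IsSweep.isUmbrella (deg_eq_ncard ((input G).mem 0)) (fun v => deg_le n _ v)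
    (fun v => near_refl hG v.2) (fun u v => near_symm hG u.2 v.2) hD.1
    (isUmbrella_of_drawing hG hD) (Fin.val_injective.comp σ.injective)
    (Fin.val_injective.comp τ.injective) (fun v => (σ v).2) h₁ h₂
  intro i j k hij hjk hk hik
  have h := this (τ.symm ⟨i, by omega⟩) (τ.symm ⟨j, by omega⟩) (τ.symm ⟨k, hk⟩) (by simpa)
    (by simpa)
  simp only [hτ] at h
  exact h hik

/-- The earlier non-neighbours of `j` form an initial segment, so their number is the position where
its neighbours begin. -/
theorem le_gap_iff {ord m : ℕ → ℕ}
    (h : IsUmbrellaOn n (fun i j => Near n m (ord i) (ord j))) {i j : ℕ} (hij : i < j)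
    (hj : j < n) : gap n m ord j ≤ i ↔ Near n m (ord i) (ord j) := by
  have hmem : ∀ x, x ∈ (Finset.range j).filter (fun x => ¬ Near n m (ord x) (ord j)) ↔
      x < j ∧ ¬ Near n m (ord x) (ord j) := by simp
  constructor
  · intro hle
    by_contra hcon
    have : Finset.range (i + 1) ⊆
        (Finset.range j).filter (fun x => ¬ Near n m (ord x) (ord j)) := fun x hx => by
      have hx := Finset.mem_range.1 hx
      exact (hmem x).2 ⟨by omega, fun hn => hcon (h x i j (by omega) hij.le hj hn).2⟩
    have := Finset.card_le_card this
    rw [Finset.card_range] at this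
    rw [gap] at hle
    omega
  · intro hnear
    have : (Finset.range j).filter (fun x => ¬ Near n m (ord x) (ord j)) ⊆ Finset.range i :=
      fun x hx => by
        by_contra hcon
        rw [Finset.mem_range, not_lt] at hcon
        obtain ⟨h1, h2⟩ := (hmem x).1 hx
        exact h2 (h i x j hcon h1.le hj hnear).2
    exact (Finset.card_le_card this).trans_eq (Finset.card_range i)

theorem gap_mono {ord m : ℕ → ℕ} (h : IsUmbrellaOn n (fun i j => Near n m (ord i) (ord j)))
    {i : ℕ} (hi : i + 1 < n) : gap n m ord i ≤ gap n m ord (i + 1) := by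
  refine Finset.card_le_card fun x hx => ?_
  simp only [Finset.mem_filter, Finset.mem_range] at hx ⊢
  exact ⟨by omega, fun hn => hx.2 (h x i (i + 1) hx.1.le (by omega) hi hn).1⟩

/-- The computed coordinates are a valid drawing. -/
theorem isValidDrawing_of_layout (hG : G.IsComplete) {ord : ℕ → ℕ} (hlt : ∀ i < n, ord i < n)
    (hinj : ∀ i < n, ∀ j < n, ord i = ord j → i = j)
    (hU : IsUmbrellaOn n (fun i j => Near n ((input G).mem 0) (ord i) (ord j)))
    {q z E X : ℕ → ℕ} (hL : IsLayout n q z E) (h0 : q 0 = 0)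
    (hq : ∀ i < n, q (i + 1) = gap n ((input G).mem 0) ord i)
    (hX : ∀ i < n, X (ord i) = E (i + 1)) :
    G.IsValidDrawing (fun i : Fin n => (X i : ℝ)) := by
  have hsurj : ∀ v : Fin n, ∃ i < n, ord i = v := by
    let f : Fin n → Fin n := fun i => ⟨ord i, hlt i i.2⟩
    have hf : Function.Injective f := fun i j e =>
      Fin.ext (hinj i i.2 j j.2 (congrArg Fin.val e))
    intro v
    obtain ⟨i, hi⟩ := (Finite.injective_iff_surjective.1 hf) v
    exact ⟨i, i.2, congrArg Fin.val hi⟩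
  have key : ∀ i j, i < j → j < n → X (ord i) < X (ord j) ∧
      (X (ord j) ≤ X (ord i) + n ↔ Near n ((input G).mem 0) (ord i) (ord j)) := by
    intro i j hij hj
    -- Positions are shifted by one against nodes: `q (j + 1) < i + 1` becomes `gap ≤ i`.
    rw [hX i (by omega), hX j hj, ← le_gap_iff hU hij hj, ← hq j hj]
    refine ⟨hL.coord_lt h0 (by omega) hj, ?_⟩
    rw [hL.coord_le_iff h0 (by omega : i + 1 < j + 1) hj]
    omega
  have hdist : ∀ u v : Fin n, dist (X u : ℝ) (X v : ℝ) ≤ n ↔ Near n ((input G).mem 0) u v := by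
    intro u v
    have hcast : dist (X u : ℝ) (X v : ℝ) ≤ n ↔ X u ≤ X v + n ∧ X v ≤ X u + n := by
      rw [Real.dist_eq, abs_sub_le_iff, sub_le_iff_le_add', sub_le_iff_le_add']
      norm_cast
    rw [hcast]
    obtain ⟨i, hi, hiu⟩ := hsurj u
    obtain ⟨j, hj, hjv⟩ := hsurj v
    rw [← hiu, ← hjv]
    rcases lt_trichotomy i j with h | rfl | h
    · have := key i j h hj
      rw [← this.2]
      omega
    · simp [near_refl hG (hlt i hi)]
    · have := key j i h hi
      rw [show Near n ((input G).mem 0) (ord i) (ord j) ↔ Near n ((input G).mem 0) (ord j) (ord i)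
        from ⟨near_symm hG (hlt i hi) (hlt j hj), near_symm hG (hlt j hj) (hlt i hi)⟩, ← this.2]
      omega
  refine ⟨fun u v huv => ?_, fun p q r hpq hpr => ?_⟩
  · have huv : X u = X v := Nat.cast_injective (R := ℝ) huv
    obtain ⟨i, hi, hiu⟩ := hsurj u
    obtain ⟨j, hj, hjv⟩ := hsurj v
    rw [← hiu, ← hjv] at huv
    rcases lt_trichotomy i j with h | rfl | h
    · exact absurd huv (key i j h hj).1.ne
    · exact Fin.ext (hiu.symm.trans hjv)
    · exact absurd huv (key j i h hi).1.ne'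
  · have h1 := (hdist p q).2 ((near_iff hG p q).2 (Or.inr hpq))
    have h2 : ¬ Near n ((input G).mem 0) p r := fun h => ((near_iff hG p r).1 h).elim
      (SignedGraph.ne_of_negAdj hpr) (SignedGraph.not_posAdj_of_negAdj hpr)
    rw [← hdist] at h2
    exact h1.trans_lt (not_le.1 h2)

theorem runs_order_input {W : ℕ} (hW : 8 * (n + 2) ^ 2 ≤ W) (hG : G.IsComplete) :
    Runs W order (input G) (fun t s => t ≤ 300 * (n + 1) ^ 2 ∧ s.reg 0 = n ∧
      s.mem 0 = (input G).mem 0 ∧ (∀ i < n, s.mem 6 i < n) ∧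
      (∀ i < n, ∀ j < n, s.mem 6 i = s.mem 6 j → i = j) ∧
      (G.HasLineDrawing →
        IsUmbrellaOn n (fun i j => Near n ((input G).mem 0) (s.mem 6 i) (s.mem 6 j)))) := by
  refine (runs_order (W := W) (n := n) hW (by simp [input]) (input_mem_le G 0)
    (fun v _ => by rw [input_mem_of_ne G (by decide)]; omega)).mono ?_
  rintro t s ⟨ht, h0, hm, ord, a, a', b, d, h₁, h₂, hd, hb, ha'⟩
  exact ⟨ht, h0, hm, h₂.lt, h₂.inj, fun hD => isUmbrellaOn_of_search hG hD h₁ h₂ hd hb ha'⟩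

theorem runs_layout_input {W : ℕ} {s : State} (hW : 8 * (n + 2) ^ 2 ≤ W) (hG : G.IsComplete)
    (hn : s.reg 0 = n) (hm : s.mem 0 = (input G).mem 0) (hlt : ∀ i < n, s.mem 6 i < n)
    (hinj : ∀ i < n, ∀ j < n, s.mem 6 i = s.mem 6 j → i = j)
    (hU : IsUmbrellaOn n (fun i j => Near n ((input G).mem 0) (s.mem 6 i) (s.mem 6 j))) :
    Runs W layout s (fun t s' => t ≤ 200 * (n + 1) ^ 2 ∧
      G.IsValidDrawing (fun i : Fin n => (s'.mem 1 i : ℝ))) := by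
  refine (runs_layout (W := W) hW hn hm rfl (input_mem_le G 0) hlt hinj
    fun i hi => gap_mono hU hi).mono ?_
  rintro t s' ⟨ht, q, z, E, hL, h0, hq, hX⟩
  exact ⟨ht, isValidDrawing_of_layout hG hlt hinj hU hL h0 hq hX⟩

/-! ### Word size and asymptotic bounds -/

/-- The number of bits of a word. -/
def wordSize (n : ℕ) : ℕ := 2 * (Nat.log 2 (n + 2) + 1) + 3

theorem le_two_pow_wordSize (n : ℕ) : 8 * (n + 2) ^ 2 ≤ 2 ^ wordSize n := by
  have h := (Nat.lt_pow_succ_log_self (b := 2) (by norm_num) (n + 2)).le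
  have e : 2 ^ wordSize n = 8 * (2 ^ (Nat.log 2 (n + 2) + 1)) ^ 2 := by
    rw [wordSize, pow_add, ← pow_mul, mul_comm 2]
    ring
  rw [e]
  exact Nat.mul_le_mul_left _ (Nat.pow_le_pow_left h 2)

theorem wordSize_isBigO : Asymptotics.IsBigO Filter.atTop (fun n => (wordSize n : ℝ))
    (fun n : ℕ => Real.log (n : ℝ)) := by
  -- From `2 ^ Nat.log 2 (n + 2) ≤ n ^ 2` and `1 / 2 < Real.log 2`, the integer logarithm is at most
  -- `4 * Real.log n`, and `5 ≤ 10 * Real.log n`; thus `18 = 2 * 4 + 10`.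
  refine Asymptotics.IsBigO.of_bound 18 ?_
  filter_upwards [Filter.eventually_ge_atTop 2] with n hn
  have hn' : (2 : ℝ) ≤ n := by exact_mod_cast hn
  have hlog2 : (1 / 2 : ℝ) < Real.log 2 := by have := Real.log_two_gt_d9; linarith
  have hlog : Real.log 2 ≤ Real.log n := Real.log_le_log (by norm_num) hn'
  have hpow : (2 : ℝ) ^ Nat.log 2 (n + 2) ≤ (n : ℝ) ^ 2 := by
    have h1 : 2 ^ Nat.log 2 (n + 2) ≤ n + 2 := Nat.pow_log_le_self 2 (by omega)
    have h2 : n + 2 ≤ n ^ 2 := by nlinarith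
    exact_mod_cast h1.trans h2
  have h3 := Real.log_le_log (by positivity) hpow
  rw [Real.log_pow, Real.log_pow] at h3
  have h4 : (0 : ℝ) ≤ Nat.log 2 (n + 2) := by positivity
  rw [Real.norm_of_nonneg (by positivity), Real.norm_of_nonneg (by linarith), wordSize]
  push_cast at h3 ⊢
  nlinarith

theorem quadratic_isBigO (c : ℕ) : Asymptotics.IsBigO Filter.atTop
    (fun n : ℕ => ((c * (n + 1) ^ 2 : ℕ) : ℝ)) (fun n : ℕ => (n : ℝ) ^ 2) := by
  refine Asymptotics.IsBigO.of_bound (4 * c) ?_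
  filter_upwards [Filter.eventually_ge_atTop 1] with n hn
  have hn' : (1 : ℝ) ≤ n := by exact_mod_cast hn
  rw [Real.norm_of_nonneg (by positivity), Real.norm_of_nonneg (by positivity)]
  push_cast
  have h1 : ((n : ℝ) + 1) ^ 2 ≤ 4 * (n : ℝ) ^ 2 := by nlinarith
  have h2 : (0 : ℝ) ≤ c := by positivity
  nlinarith

end

end WordRAM

theorem mainTheorem1 :
    WordRAM.SolvableInTime (fun n => (n : ℝ) ^ 2)
      (fun _ G => G.IsComplete)
      (fun _ G s => (G.HasLineDrawing → s.reg 0 = 1) ∧ (¬ G.HasLineDrawing → s.reg 0 = 0)) ∧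
    WordRAM.SolvableInTime (fun n => (n : ℝ) ^ 2)
      (fun _ G => G.IsComplete ∧ G.HasLineDrawing)
      (fun n G s => G.IsValidDrawing (fun i : Fin n => (s.mem 1 (i : ℕ) : ℝ))) := by
  open WordRAM in
  constructor
  · refine ⟨.seq order check, fun n => 400 * (n + 1) ^ 2, wordSize, quadratic_isBigO 400,
      wordSize_isBigO, fun n G hG => ?_⟩
    have hW := le_two_pow_wordSize n
    suffices Runs (2 ^ wordSize n) (.seq order check) (input G) (fun t s =>
        t ≤ 400 * (n + 1) ^ 2 ∧ (G.HasLineDrawing → s.reg 0 = 1) ∧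
          (¬ G.HasLineDrawing → s.reg 0 = 0)) from this
    rw [Runs.seq_iff]
    refine (runs_order_input hW hG).mono ?_
    rintro t s ⟨ht, h0, hm, hlt, hinj, hU⟩
    refine (runs_check hW h0 hm rfl (input_mem_le G 0) hlt).mono ?_
    rintro t' s' ⟨ht', h1, hiff⟩
    rw [isUmbrellaOn_iff (r := fun i j => Near n ((input G).mem 0) (s.mem 6 i) (s.mem 6 j))
      fun i hi => near_refl hG (hlt i hi)] at hiff
    refine ⟨by omega, fun hD => hiff.2 (hU hD), fun hD => ?_⟩
    by_contra hne
    -- Soundness of acceptance: a run of `layout`, used only inside the proof, turns the verified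
    -- umbrella order into a drawing.
    obtain ⟨-, s'', -, -, hvalid⟩ :=
      runs_layout_input hW hG h0 hm hlt hinj (hiff.1 (by omega))
    exact hD ⟨_, hvalid⟩
  · refine ⟨.seq order layout, fun n => 500 * (n + 1) ^ 2, wordSize, quadratic_isBigO 500,
      wordSize_isBigO, fun n G hG => ?_⟩
    have hW := le_two_pow_wordSize n
    suffices Runs (2 ^ wordSize n) (.seq order layout) (input G) (fun t s =>
        t ≤ 500 * (n + 1) ^ 2 ∧ G.IsValidDrawing (fun i : Fin n => (s.mem 1 (i : ℕ) : ℝ))) from this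
    rw [Runs.seq_iff]
    refine (runs_order_input hW hG.1).mono ?_
    rintro t s ⟨ht, h0, hm, hlt, hinj, hU⟩
    refine (runs_layout_input hW hG.1 h0 hm hlt hinj (hU hG.2)).mono ?_
    rintro t' s' ⟨ht', hvalid⟩
    exact ⟨by omega, hvalid⟩
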